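/- Let $\Omega\subset\mathbb R^n$ be an open set which is bounded in one direction (it lies between two parallel hyperplanes), let $0<s<1$, and let $W\subset\Omega_e:=\mathbb R^n\setminus\overline\Omega$ be a nonempty open set. Let $\nabla^s u(x,y)=\sqrt{C_{n,s}/2}\,\frac{u(x)-u(y)}{|x-y|^{n/2+s+1}}(x-y)$ with $C_{n,s}=\frac{4^s\Gamma(n/2+s)}{\pi^{n/2}|\Gamma(-s)|}$. For a conductivity $\gamma\in L^\infty(\mathbb R^n)$ with $\gamma\ge\gamma_0$ a.e. for some constant $\gamma_0>0$, let $$B_\gamma(u,v)=\int_{\mathbb R^{2n}}\gamma^{1/2}(x)\gamma^{1/2}(y)\,\nabla^su\cdot\nabla^sv\,dx\,dy,\qquad \langle\Lambda_\gamma f,g\rangle=B_\gamma(u_f,g)\qquad(f,g\in H^s(\mathbb R^n)),$$ where $u_f\in H^s(\mathbb R^n)$ is the unique function with $u_f-f\in\widetilde H^s(\Omega)$ (the closure of $C_c^\infty(\Omega)$ in $H^s(\mathbb R^n)$) and $B_\gamma(u_f,\phi)=0$ for all $\phi\in\widetilde H^s(\Omega)$. No Sobolev regularity of the conductivities is assumed.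 1. (Exterior determination.) Let $\gamma_1,\gamma_2$ be conductivities as above which (for suitable representatives) are continuous at a.e. point of $W$. If $\Lambda_{\gamma_1}f|_W=\Lambda_{\gamma_2}f|_W$ for all $f\in C_c^\infty(W)$, that is, $\langle\Lambda_{\gamma_1}f,g\rangle=\langle\Lambda_{\gamma_2}f,g\rangle$ for all $f,g\in C_c^\infty(W)$, then $\gamma_1=\gamma_2$ a.e. in $W$. 2. (Reconstruction.) For every $x_0\in W$ there is a sequence $(\phi_N)_{N\in\mathbb N}\subset C_c^\infty(W)$, which does not depend on the conductivity, such that $\|\phi_N\|_{L^2(\mathbb R^n)}^2+\|\nabla^s\phi_N\|_{L^2(\mathbb R^{2n})}^2=1$ for all $N$, $\|\phi_N\|_{L^2(\mathbb R^n)}\to0$, the supports of $\phi_N$ shrink to $\{x_0\}$, and $$\gamma(x_0)=\lim_{N\to\infty}\langle\Lambda_\gamma\phi_N,\phi_N\rangle$$ for every conductivity $\gamma$ as above that is continuous at $x_0$. In particular, if $\gamma$ is continuous a.e. in $W$, this holds for a.e. $x_0\in W$. -/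

import Mathlib

open MeasureTheory Filter TopologicalSpace
open scoped ENNReal Topology FourierTransform Distributions

noncomputable section

namespace FracCond

/-- Euclidean space `ℝⁿ`. -/
abbrev Rn (n : ℕ) : Type := EuclideanSpace ℝ (Fin n)

/-- Real-valued `L²(ℝⁿ)` (functions up to equality a.e.). -/
abbrev L2 (n : ℕ) : Type := Lp ℝ 2 (volume : Measure (Rn n))

/-- A test function `φ ∈ C_c^∞(U)` (`𝓓(U, ℝ)` is Mathlib's space of smooth real functions on `ℝⁿ`
with compact support contained in the open set `U`), seen as an element of `L²(ℝⁿ)`. -/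
def testL2 {n : ℕ} {U : Opens (Rn n)} (φ : 𝓓(U, ℝ)) : L2 n :=
  (φ.continuous.memLp_of_hasCompactSupport (p := 2) (μ := volume) φ.hasCompactSupport).toLp φ

/-- The Fourier transform of a real-valued `L²` function, with Mathlib's normalization
`∫ u(x) exp(-2πi x·ξ) dx`. -/
def fourierL2 {n : ℕ} (u : L2 n) : Lp ℂ 2 (volume : Measure (Rn n)) :=
  𝓕 (Complex.ofRealCLM.compLp u)

/-- The Bessel potential norm `‖⟨D⟩^s u‖_{L²}` of `u ∈ L²(ℝⁿ)`, valued in `[0, ∞]`. It is computed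
on the Fourier side (Plancherel); with the normalization of `fourierL2` the symbol of
`⟨D⟩^s = (1 - Δ)^{s/2}` is `(1 + |2πξ|²)^{s/2}`. -/
def hsNorm {n : ℕ} (s : ℝ) (u : L2 n) : ℝ≥0∞ :=
  eLpNorm (fun ξ : Rn n => ((1 + (2 * Real.pi * ‖ξ‖) ^ 2) ^ (s / 2) : ℝ) • fourierL2 u ξ) 2 volume

/-- `u ∈ H^s(ℝⁿ)`, where `s ≥ 0` (so that `H^s ⊆ L²`). -/
def MemHs {n : ℕ} (s : ℝ) (u : L2 n) : Prop :=
  hsNorm s u < ⊤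

/-- `u ∈ H̃^s(Ω)`, the closure of `C_c^∞(Ω)` in `H^s(ℝⁿ)`. -/
def MemHsTilde {n : ℕ} (Ω : Opens (Rn n)) (s : ℝ) (u : L2 n) : Prop :=
  MemHs s u ∧ ∀ ε : ℝ≥0∞, 0 < ε → ∃ φ : 𝓓(Ω, ℝ), hsNorm s (u - testL2 φ) < ε

/-- The constant `C_{n,s} = 4^s Γ(n/2 + s) / (π^{n/2} |Γ(-s)|)` of the fractional Laplacian. -/
def fracConst (n : ℕ) (s : ℝ) : ℝ :=
  (4 : ℝ) ^ s * Real.Gamma ((n : ℝ) / 2 + s) /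
    (Real.pi ^ ((n : ℝ) / 2) * |Real.Gamma (-s)|)

/-- The fractional gradient
`∇^s u (x, y) = √(C_{n,s} / 2) (u(x) - u(y)) / |x - y|^{n/2 + s + 1} (x - y)`. -/
def fracGrad {n : ℕ} (s : ℝ) (u : L2 n) (p : Rn n × Rn n) : Rn n :=
  (√(fracConst n s / 2) * ((u p.1 - u p.2) / ‖p.1 - p.2‖ ^ ((n : ℝ) / 2 + s + 1))) • (p.1 - p.2)

/-- The bilinear form
`B_γ(u, v) = ∫_{ℝ²ⁿ} γ^{1/2}(x) γ^{1/2}(y) ∇^s u (x, y) · ∇^s v (x, y) dx dy`. -/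
def condForm {n : ℕ} (s : ℝ) (γ : Rn n → ℝ) (u v : L2 n) : ℝ :=
  ∫ p : Rn n × Rn n, √(γ p.1) * √(γ p.2) * inner ℝ (fracGrad s u p) (fracGrad s v p)

/-- `u` is a weak solution of the fractional conductivity equation
`div_s (Θ_γ ∇^s u) = 0` in `Ω`, `u = f` in `Ω_e`. -/
def IsWeakSolution {n : ℕ} (Ω : Opens (Rn n)) (s : ℝ) (γ : Rn n → ℝ) (f u : L2 n) : Prop :=
  MemHs s u ∧ MemHsTilde Ω s (u - f) ∧ ∀ φ : L2 n, MemHsTilde Ω s φ → condForm s γ u φ = 0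

open Classical in
/-- The exterior Dirichlet-to-Neumann map as a pairing: `⟨Λ_γ f, g⟩ = B_γ(u_f, g)`, where `u_f` is
the weak solution with exterior value `f`. (For `Ω` bounded in one direction, `0 < s < 1`, a
uniformly elliptic `γ` and `f ∈ H^s(ℝⁿ)` this solution exists and is unique; the value `0` in the
absence of a solution plays no role.) -/
def dnMap {n : ℕ} (Ω : Opens (Rn n)) (s : ℝ) (γ : Rn n → ℝ) (f g : L2 n) : ℝ :=
  if h : ∃ u : L2 n, IsWeakSolution Ω s γ f u then condForm s γ h.choose g else 0

/-- A set is bounded in one direction if it lies between two parallel hyperplanes. -/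
def BoundedInOneDirection {n : ℕ} (Ω : Set (Rn n)) : Prop :=
  ∃ v : Rn n, ‖v‖ = 1 ∧ ∃ a b : ℝ, ∀ x ∈ Ω, a ≤ inner ℝ v x ∧ inner ℝ v x ≤ b

/-- `γ ∈ L^∞(ℝⁿ)` with `γ ≥ γ₀ > 0` a.e. for some constant `γ₀`. -/
def IsConductivity {n : ℕ} (γ : Rn n → ℝ) : Prop :=
  MemLp γ ⊤ volume ∧ ∃ γ₀ : ℝ, 0 < γ₀ ∧ ∀ᵐ x, γ₀ ≤ γ x

/-- Test functions `φ N ∈ C_c^∞(W)` whose energy concentrates at `x₀`: they are normalized by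
`‖φ N‖²_{L²} + ‖∇^s φ N‖²_{L²} = 1`, tend to `0` in `L²`, and their supports shrink to `{x₀}`. -/
structure ConcentratesAt {n : ℕ} {W : Opens (Rn n)} (s : ℝ) (φ : ℕ → 𝓓(W, ℝ)) (x₀ : Rn n) :
    Prop where
  normalized : ∀ N, eLpNorm (φ N) 2 volume ^ 2 + eLpNorm (fracGrad s (testL2 (φ N))) 2 volume ^ 2 = 1
  tendsto_zero : Tendsto (fun N => eLpNorm (φ N) 2 volume) atTop (𝓝 0)
  support_shrinks : ∀ ε : ℝ, 0 < ε → ∀ᶠ N in atTop, tsupport (φ N) ⊆ Metric.ball x₀ ε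

end FracCond

end

namespace FracCond

open scoped SchwartzMap RealInnerProductSpace

variable {n : ℕ} {s : ℝ}

/-! Fix `x₀ ∈ W` and let `f` be supported in a small ball around `x₀`, at positive distance from
`Ω`. Write `u_f = f + w` with `w ∈ H̃^s(Ω)`. Testing the equation with `w` gives `⟨Λ_γ f, f⟩ -
B_γ(f, f) = B_γ(w, f) = -B_γ(w, w)`. Since `w` and `f` have separated supports, only cross terms
survive in `B_γ(w, f)`, and there the kernel is integrable, so Young's inequality bounds it by small
multiples of `‖w‖²` plus large multiples of `‖f‖²` in `L²`. The Poincaré inequality on `Ω` and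
ellipticity absorb the `w` term, so the error is `O(‖f‖²_{L²})` (`exists_enorm_dnMap_sub_le`).

It remains to evaluate `B_γ(f, f)`. For pairs of points near `x₀` the weight is close to `γ(x₀)` by
continuity; all other pairs again cost only `‖f‖²_{L²}` (`enorm_condForm_sub_le`). Hence for
normalized `φ_N` whose supports shrink to `x₀` and whose `L²` norms tend to `0`, the pairing tends
to `γ(x₀)` (`tendsto_dnMap_of_concentratesAt`). The vanishing of the `L²` norms is automatic: a
function of bounded energy supported in a strip of width `ε` has squared `L²` norm `O(ε^{2s})`
(`eLpNorm_le_gagliardo_of_strip`). Exterior determination follows by uniqueness of limits, because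
the `φ_N` do not depend on `γ`.

Two preparations support this: the Fourier norm `hsNorm` is compared with the Gagliardo seminorm,
and weak solutions are obtained by orthogonal projection. Uniqueness of the solution is never
needed, as the estimates hold for every weak solution. -/

theorem fracConst_pos (hs0 : 0 < s) (hs1 : s < 1) : 0 < fracConst n s := by
  have h : Real.Gamma (-s) ≠ 0 := by
    refine Real.Gamma_ne_zero fun m hm => ?_
    have hm' : (m : ℝ) = s := by linarith
    rcases m with _ | m
    · simp at hm'; linarith
    · push_cast at hm'; have : (0 : ℝ) ≤ m := m.cast_nonneg; linarith
  have h1 : 0 < Real.Gamma ((n : ℝ) / 2 + s) := Real.Gamma_pos_of_pos (by positivity)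
  have h2 : 0 < |Real.Gamma (-s)| := abs_pos.mpr h
  unfold fracConst
  positivity

/-! ### The fractional gradient and the Gagliardo seminorm -/

/-- The kernel `|z|^{-n-2s}` of the Gagliardo seminorm. -/
noncomputable def fracKernel (s : ℝ) (z : Rn n) : ℝ≥0∞ :=
  ENNReal.ofReal (‖z‖ ^ (-((n : ℝ) + 2 * s)))

@[fun_prop]
theorem measurable_fracKernel : Measurable (fracKernel (n := n) s) := by
  unfold fracKernel; fun_prop

theorem fracKernel_neg (z : Rn n) : fracKernel s (-z) = fracKernel s z := by
  simp [fracKernel]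

/-- The square of the Gagliardo seminorm. -/
noncomputable def gagliardo (s : ℝ) (u : Rn n → ℝ) : ℝ≥0∞ :=
  ∫⁻ h : Rn n, fracKernel s h * ∫⁻ y : Rn n, ‖u (h + y) - u y‖ₑ ^ 2

theorem lintegral_prod_sub {F : Rn n × Rn n → ℝ≥0∞} (hF : Measurable F) :
    ∫⁻ p : Rn n × Rn n, F (p.1 - p.2, p.2) = ∫⁻ h : Rn n, ∫⁻ y : Rn n, F (h, y) := by
  rw [Measure.volume_eq_prod, lintegral_prod_symm _ (by fun_prop),
    lintegral_lintegral_swap (f := fun h y => F (h, y)) (by exact hF.aemeasurable)]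
  refine lintegral_congr fun y => ?_
  exact (lintegral_add_right_eq_self (fun x => F (x - y, y)) y).symm.trans (by simp)

theorem gagliardo_eq_lintegral_prod {u : Rn n → ℝ} (hu : Measurable u) :
    ∫⁻ p : Rn n × Rn n, fracKernel s (p.1 - p.2) * ‖u p.1 - u p.2‖ₑ ^ 2 = gagliardo s u := by
  have := lintegral_prod_sub (n := n)
    (F := fun q => fracKernel s q.1 * ‖u (q.1 + q.2) - u q.2‖ₑ ^ 2) (by fun_prop)
  simp only [sub_add_cancel] at this
  rw [this, gagliardo]
  refine lintegral_congr fun h => ?_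
  rw [lintegral_const_mul _ (by fun_prop)]

/-- The scalar factor of the fractional gradient, with `|x - y|` absorbed. -/
noncomputable def fracQuot (s : ℝ) (u : Rn n → ℝ) (p : Rn n × Rn n) : ℝ :=
  √(fracConst n s / 2) * ((u p.1 - u p.2) / ‖p.1 - p.2‖ ^ ((n : ℝ) / 2 + s))

/-- The vector `x - y` contributes `|x - y|²`, which lowers each exponent by one; on the diagonal
both sides vanish. This reduces the vector-valued gradient to a scalar quotient. -/
theorem inner_fracGrad (u v : L2 n) (p : Rn n × Rn n) :
    inner ℝ (fracGrad s u p) (fracGrad s v p) = fracQuot s u p * fracQuot s v p := by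
  rw [fracGrad, fracGrad, fracQuot, fracQuot, inner_smul_left, inner_smul_right,
    real_inner_self_eq_norm_sq]
  rcases eq_or_ne p.1 p.2 with h | h
  · simp [h]
  · have : 0 < ‖p.1 - p.2‖ := norm_pos_iff.mpr (sub_ne_zero.mpr h)
    rw [Real.rpow_add this _ 1, Real.rpow_one]
    have h2 : ‖p.1 - p.2‖ ^ ((n : ℝ) / 2 + s) ≠ 0 := (Real.rpow_pos_of_pos this _).ne'
    simp only [conj_trivial]
    field_simp

theorem measurable_fracQuot {u : Rn n → ℝ} (hu : Measurable u) : Measurable (fracQuot s u) := by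
  unfold fracQuot; fun_prop

theorem enorm_fracQuot_sq (hs0 : 0 < s) (hs1 : s < 1) (u : Rn n → ℝ) (p : Rn n × Rn n) :
    ‖fracQuot s u p‖ₑ ^ 2 = ENNReal.ofReal (fracConst n s / 2) *
      (fracKernel s (p.1 - p.2) * ‖u p.1 - u p.2‖ₑ ^ 2) := by
  have hc := fracConst_pos (n := n) hs0 hs1
  simp only [fracKernel, Real.enorm_eq_ofReal_abs]
  rw [← ENNReal.ofReal_pow (abs_nonneg _), ← ENNReal.ofReal_pow (abs_nonneg _),
    ← ENNReal.ofReal_mul (by positivity), ← ENNReal.ofReal_mul (by positivity), sq_abs, sq_abs,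
    fracQuot, mul_pow, Real.sq_sqrt (by positivity), div_pow,
    ← Real.rpow_natCast (‖p.1 - p.2‖ ^ _), ← Real.rpow_mul (norm_nonneg _), Real.rpow_neg (norm_nonneg _)]
  congr 2
  rw [div_eq_inv_mul]
  congr 3
  push_cast; ring

theorem enorm_fracGrad (u : L2 n) (p : Rn n × Rn n) :
    ‖fracGrad s u p‖ₑ = ‖fracQuot s u p‖ₑ := by
  have : ‖fracGrad s u p‖ = ‖fracQuot s u p‖ := by
    have h := inner_fracGrad (s := s) u u p
    rw [real_inner_self_eq_norm_sq, ← sq, ← sq_abs (fracQuot s u p)] at h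
    exact (sq_eq_sq₀ (norm_nonneg _) (abs_nonneg _)).mp h
  rw [← ofReal_norm, this, ofReal_norm]

theorem lintegral_fracQuot_sq (hs0 : 0 < s) (hs1 : s < 1) {u : Rn n → ℝ} (hu : Measurable u) :
    ∫⁻ p, ‖fracQuot s u p‖ₑ ^ 2 = ENNReal.ofReal (fracConst n s / 2) * gagliardo s u := by
  simp_rw [enorm_fracQuot_sq hs0 hs1]
  rw [lintegral_const_mul _ (by fun_prop), gagliardo_eq_lintegral_prod hu]

theorem eLpNorm_two_sq {α E : Type*} [MeasurableSpace α] [NormedAddCommGroup E] (μ : Measure α)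
    (f : α → E) : eLpNorm f 2 μ ^ 2 = ∫⁻ x, ‖f x‖ₑ ^ 2 ∂μ := by
  have := eLpNorm_nnreal_pow_eq_lintegral (μ := μ) (f := f) (p := 2) (by norm_num)
  simpa using this

theorem measurable_coe_L2 (u : L2 n) : Measurable u := (Lp.stronglyMeasurable u).measurable

theorem eLpNorm_fracGrad_sq (hs0 : 0 < s) (hs1 : s < 1) (u : L2 n) :
    eLpNorm (fracGrad s u) 2 volume ^ 2 =
      ENNReal.ofReal (fracConst n s / 2) * gagliardo s u := by
  rw [eLpNorm_two_sq, ← lintegral_fracQuot_sq hs0 hs1 (measurable_coe_L2 u)]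
  simp_rw [enorm_fracGrad]

theorem gagliardo_congr {u v : Rn n → ℝ} (h : u =ᵐ[volume] v) : gagliardo s u = gagliardo s v := by
  unfold gagliardo
  refine lintegral_congr fun z => ?_
  congr 1
  refine lintegral_congr_ae ?_
  have := (measurePreserving_add_left (volume : Measure (Rn n)) z).quasiMeasurePreserving.ae_eq_comp h
  filter_upwards [h, this] with y h1 h2
  simp only [Function.comp_apply] at h2
  rw [h1, h2]

/-! ### Integrals of the kernel -/

/-- Away from the origin `1 + |z| ≤ (1/δ + 1) |z|`, so the kernel is dominated by a multiple of `(1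
+ |z|)^{-n-2s}`, which is integrable because `n + 2s > n`. -/
theorem lintegral_fracKernel_tail (hs0 : 0 < s) {δ : ℝ} (hδ : 0 < δ) :
    ∫⁻ z in {z : Rn n | δ ≤ ‖z‖}, fracKernel s z < ⊤ := by
  set r : ℝ := (n : ℝ) + 2 * s with hr
  have hr0 : 0 < r := by positivity
  have hfin : (Module.finrank ℝ (Rn n) : ℝ) < r := by simp [hr]; linarith
  have hJ := finite_integral_one_add_norm (E := Rn n) (μ := volume) hfin
  refine lt_of_le_of_lt (b := ENNReal.ofReal ((1 / δ + 1) ^ r) *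
    ∫⁻ z : Rn n, ENNReal.ofReal ((1 + ‖z‖) ^ (-r))) ?_ (ENNReal.mul_lt_top (by simp) hJ)
  rw [← lintegral_const_mul _ (by fun_prop)]
  refine (setLIntegral_mono (by fun_prop) fun z hz => ?_).trans (setLIntegral_le_lintegral _ _)
  have hz' : δ ≤ ‖z‖ := hz
  have hz0 : 0 < ‖z‖ := hδ.trans_le hz'
  rw [fracKernel, ← ENNReal.ofReal_mul (by positivity)]
  refine ENNReal.ofReal_le_ofReal ?_
  rw [← hr, Real.rpow_neg hz0.le, Real.rpow_neg (by positivity), ← div_eq_mul_inv,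
    ← Real.div_rpow (by positivity) (by positivity), ← Real.inv_rpow hz0.le]
  refine Real.rpow_le_rpow (by positivity) ?_ hr0.le
  rw [inv_eq_one_div, div_le_div_iff₀ hz0 (by positivity)]
  have : 1 ≤ 1 / δ * ‖z‖ := by rw [div_mul_eq_mul_div, one_mul, le_div_iff₀ hδ]; linarith
  nlinarith

/-- The integrand is `|z|^{-(n+2s-2)}`, and `s < 1` makes `n + 2s - 2` smaller than the dimension.
-/
theorem lintegral_fracKernel_mul_sq_ball (hn : 1 ≤ n) (hs1 : s < 1) :
    ∫⁻ z in Metric.ball (0 : Rn n) 1, fracKernel s z * ‖z‖ₑ ^ 2 < ⊤ := by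
  have h := integrableOn_ball_of_norm_le_rpow (E := Rn n) (μ := volume) (F := ℝ)
    (f := fun z => ‖z‖ ^ (-((n : ℝ) + 2 * s)) * ‖z‖ ^ 2) (C := 1) (α := n + 2 * s - 2) (r := 1)
    (by simpa using hn) (by simp; linarith) ?_ (by fun_prop)
  · refine lt_of_eq_of_lt (lintegral_congr fun z => ?_) h.2
    rw [fracKernel, enorm_mul, Real.enorm_of_nonneg (by positivity), enorm_pow, enorm_norm]
  · refine Filter.Eventually.of_forall fun z => ?_
    rcases eq_or_ne z 0 with rfl | hz
    · simp; positivity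
    · have hz0 : 0 < ‖z‖ := norm_pos_iff.mpr hz
      rw [← Real.rpow_natCast, ← Real.rpow_add hz0, Real.norm_of_nonneg (by positivity), one_mul]
      apply le_of_eq; congr 1; push_cast; ring

/-! ### A Poincaré inequality for functions supported in a strip -/

/-- If `u` vanishes outside a strip that is narrower than `ε`, then `u` is controlled by its
Gagliardo seminorm, with a constant that blows up as `ε → 0`. -/
theorem eLpNorm_le_gagliardo_of_strip (hs0 : 0 < s) {u : Rn n → ℝ} {v : Rn n}
    (hv : ‖v‖ = 1) {a ε : ℝ} (hε : 0 < ε)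
    (h0 : ∀ᵐ x, x ∉ {x : Rn n | a ≤ inner ℝ v x ∧ inner ℝ v x ≤ a + ε} → u x = 0) :
    ENNReal.ofReal ((4 * ε) ^ (-((n : ℝ) + 2 * s)) * ε ^ n) * volume (Metric.ball (0 : Rn n) 1) *
      ∫⁻ x, ‖u x‖ₑ ^ 2 ≤ gagliardo s u := by
  -- A translation by `h ∈ A` has component larger than `2ε` along `v`, so it moves the strip off
  -- itself: if `y` is in the strip, `h + y` is not. Hence `|u(h + y) - u(y)| ≥ |u(y)|` for almost
  -- every `y`, and `|h| ≤ 4ε` bounds the kernel from below.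
  set A : Set (Rn n) := Metric.ball ((3 * ε) • v) ε with hA
  have hvol : volume A = ENNReal.ofReal (ε ^ n) * volume (Metric.ball (0 : Rn n) 1) := by
    rw [hA, Measure.addHaar_ball_of_pos _ _ hε]; simp
  have hAn : ∀ z ∈ A, ‖z‖ ≤ 4 * ε ∧ 2 * ε < inner ℝ v z := by
    intro z hz
    rw [hA, mem_ball_iff_norm] at hz
    constructor
    · calc ‖z‖ = ‖(z - (3 * ε) • v) + (3 * ε) • v‖ := by simp
        _ ≤ ‖z - (3 * ε) • v‖ + ‖(3 * ε) • v‖ := norm_add_le _ _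
        _ ≤ ε + 3 * ε := by
          gcongr
          rw [norm_smul, hv, Real.norm_of_nonneg (by positivity), mul_one]
        _ = 4 * ε := by ring
    · have h1 : |inner ℝ v (z - (3 * ε) • v)| ≤ ‖z - (3 * ε) • v‖ := by
        simpa [hv] using abs_real_inner_le_norm v (z - (3 * ε) • v)
      rw [inner_sub_right, inner_smul_right, real_inner_self_eq_norm_sq, hv] at h1
      have := (abs_le.mp h1).1
      linarith
  calc _ = ∫⁻ h in A, ENNReal.ofReal ((4 * ε) ^ (-((n : ℝ) + 2 * s))) * ∫⁻ x, ‖u x‖ₑ ^ 2 := by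
        rw [setLIntegral_const, hvol, ENNReal.ofReal_mul (by positivity)]; ring
    _ ≤ ∫⁻ h in A, fracKernel s h * ∫⁻ y : Rn n, ‖u (h + y) - u y‖ₑ ^ 2 := by
        refine setLIntegral_mono' Metric.isOpen_ball.measurableSet fun h hh => ?_
        obtain ⟨h1, h2⟩ := hAn h hh
        refine mul_le_mul' ?_ ?_
        · rw [fracKernel]
          refine ENNReal.ofReal_le_ofReal ?_
          refine Real.rpow_le_rpow_of_nonpos ?_ h1 (by
            have : (0 : ℝ) ≤ n := n.cast_nonneg
            linarith)
          rw [norm_pos_iff]; rintro rfl; simp at h2; linarith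
        · refine lintegral_mono_ae ?_
          have h3 := (measurePreserving_add_left (volume : Measure (Rn n)) h
            ).quasiMeasurePreserving.ae h0
          filter_upwards [h0, h3] with y hy hy'
          by_cases hyS : y ∈ {x : Rn n | a ≤ inner ℝ v x ∧ inner ℝ v x ≤ a + ε}
          · have : u (h + y) = 0 := by
              refine hy' fun hmem => ?_
              simp only [Set.mem_ofPred_eq, inner_add_right] at hmem hyS
              linarith [hmem.2, hyS.1]
            simp [this]
          · simp [hy hyS]
    _ ≤ gagliardo s u := setLIntegral_le_lintegral _ _

/-! ### Plancherel's theorem for differences and the Fourier symbol -/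

/-- Complex-valued `L²(ℝⁿ)`. -/
abbrev L2C (n : ℕ) : Type := Lp ℂ 2 (volume : Measure (Rn n))

/-- The Fourier character `exp(2πi h·ξ)`. -/
noncomputable def fourierPhase (h ξ : Rn n) : ℂ := (Real.fourierChar ⟪h, ξ⟫ : ℂ)

theorem norm_fourierPhase (h ξ : Rn n) : ‖fourierPhase h ξ‖ = 1 := Circle.norm_coe _

@[fun_prop]
theorem measurable_fourierPhase {α : Type*} [MeasurableSpace α] {f g : α → Rn n}
    (hf : Measurable f) (hg : Measurable g) : Measurable fun x => fourierPhase (f x) (g x) :=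
  (continuous_subtype_val.comp Real.continuous_fourierChar).measurable.comp (hf.inner hg)

/-- Translation by `h` as an isometry of `L²`. -/
noncomputable def translate (h : Rn n) :
    L2C n →ₗᵢ[ℂ] L2C n :=
  Lp.compMeasurePreservingₗᵢ ℂ (h + ·) (measurePreserving_add_left volume h)

theorem coeFn_translate (h : Rn n) (u : L2C n) :
    translate h u =ᵐ[volume] fun x => u (h + x) :=
  Lp.coeFn_compMeasurePreserving u (measurePreserving_add_left volume h)

theorem fourier_translate_schwartz (h : Rn n) (f : 𝓢(Rn n, ℂ)) :
    (𝓕 (translate h (f.toLp 2 volume)) : L2C n) =ᵐ[volume]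
      fun ξ => fourierPhase h ξ * (𝓕 (f.toLp 2 volume) : L2C n) ξ := by
  have h1 : translate h (f.toLp 2 volume) = (f.compSubConstCLM ℂ (-h)).toLp 2 volume := by
    refine Lp.ext ?_
    have h2 := (measurePreserving_add_left (volume : Measure (Rn n)) h
      ).quasiMeasurePreserving.ae_eq_comp (f.coeFn_toLp 2 volume)
    filter_upwards [coeFn_translate h (f.toLp 2 volume), h2,
      (f.compSubConstCLM ℂ (-h)).coeFn_toLp 2 volume] with x hx hx2 hx3
    simp only [Function.comp_apply] at hx2
    rw [hx, hx2, hx3, SchwartzMap.compSubConstCLM_apply]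
    congr 1; abel
  rw [h1, SchwartzMap.toLp_fourier_eq, SchwartzMap.toLp_fourier_eq]
  filter_upwards [(𝓕 (f.compSubConstCLM ℂ (-h))).coeFn_toLp 2 volume,
    (𝓕 f).coeFn_toLp 2 volume] with ξ h2 h3
  rw [h2, h3, SchwartzMap.fourier_coe, SchwartzMap.fourier_coe]
  have h4 := congrFun (VectorFourier.fourierIntegral_comp_add_right Real.fourierChar
    (volume : Measure (Rn n)) (innerₗ (Rn n)) (f : Rn n → ℂ) h) ξ
  have h5 : ((f.compSubConstCLM ℂ (-h) : 𝓢(Rn n, ℂ)) : Rn n → ℂ) = f ∘ fun v => v + h := by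
    ext v; simp
  rw [h5]
  exact h4

/-- Density of Schwartz functions: both sides are linear and isometric in `u`, so the identity
passes to all of `L²`. -/
theorem fourier_translate (h : Rn n) (u : L2C n) :
    (𝓕 (translate h u) : L2C n) =ᵐ[volume] fun ξ => fourierPhase h ξ * (𝓕 u : L2C n) ξ := by
  have hmeas : ∀ v : L2C n,
      AEStronglyMeasurable (fun ξ => fourierPhase h ξ * (𝓕 v : L2C n) ξ) volume := fun v =>
    (Measurable.aestronglyMeasurable (by fun_prop)).mul (Lp.aestronglyMeasurable _)
  have hnorm : ∀ v : L2C n,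
      eLpNorm (fun ξ => fourierPhase h ξ * (𝓕 v : L2C n) ξ) 2 volume = ‖v‖ₑ := by
    intro v
    rw [← ofReal_norm, ← Lp.norm_fourier_eq v, ofReal_norm, Lp.enorm_def]
    refine eLpNorm_congr_norm_ae (Eventually.of_forall fun ξ => ?_)
    rw [norm_mul, norm_fourierPhase, one_mul]
  suffices H : eLpNorm (fun ξ => (𝓕 (translate h u) : L2C n) ξ - fourierPhase h ξ * (𝓕 u : L2C n) ξ) 2 volume = 0 by
    replace H := (eLpNorm_eq_zero_iff ((Lp.aestronglyMeasurable _).sub (hmeas u)) (by simp)).mp H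
    filter_upwards [H] with ξ hξ
    exact sub_eq_zero.mp hξ
  refine le_antisymm (ENNReal.le_of_forall_pos_le_add fun ε hε _ => ?_) zero_le
  rw [zero_add]
  obtain ⟨f, hf⟩ := Metric.denseRange_iff.mp (SchwartzMap.denseRange_toLpCLM
    (E := Rn n) (F := ℂ) (p := 2) (μ := volume) (by simp)) u (ε / 2) (by positivity)
  rw [SchwartzMap.toLpCLM_apply, dist_eq_norm] at hf
  set g : L2C n := f.toLp 2 volume
  -- The identity is exact for the Schwartz approximant `g`, so the defect of `u` equals that of `u
  -- - g`.
  have e1 : (fun ξ => (𝓕 (translate h u) : L2C n) ξ - fourierPhase h ξ * (𝓕 u : L2C n) ξ) =ᵐ[volume]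
      (fun ξ => (𝓕 (translate h (u - g)) : L2C n) ξ) - fun ξ => fourierPhase h ξ * (𝓕 (u - g) : L2C n) ξ := by
    have a1 : (𝓕 (translate h (u - g)) : L2C n) = 𝓕 (translate h u) - 𝓕 (translate h g) := by
      rw [map_sub]; exact (Lp.fourierTransformₗᵢ (Rn n) ℂ).map_sub _ _
    have a2 : (𝓕 (u - g) : L2C n) = 𝓕 u - 𝓕 g := (Lp.fourierTransformₗᵢ (Rn n) ℂ).map_sub _ _
    rw [a1, a2]
    filter_upwards [fourier_translate_schwartz h f, Lp.coeFn_sub (𝓕 (translate h u))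
      (𝓕 (translate h g)), Lp.coeFn_sub (𝓕 u) (𝓕 g)] with ξ b1 b2 b3
    simp only [Pi.sub_apply, b2, b3]
    rw [show (𝓕 (translate h g) : L2C n) ξ = _ from b1]
    ring
  rw [eLpNorm_congr_ae e1]
  refine (eLpNorm_sub_le (Lp.aestronglyMeasurable _) (hmeas _) (by norm_num)).trans ?_
  rw [hnorm, ← Lp.enorm_def, ← ofReal_norm (𝓕 _), Lp.norm_fourier_eq, LinearIsometry.norm_map,
    ofReal_norm]
  have : ‖u - g‖ₑ ≤ (ε / 2 : NNReal) := by
    rw [← ofReal_norm]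
    exact ENNReal.ofReal_le_of_le_toReal (by simpa using hf.le)
  calc _ ≤ ((ε / 2 : NNReal) : ℝ≥0∞) + (ε / 2 : NNReal) := add_le_add this this
    _ = ε := by rw [← ENNReal.coe_add, add_halves]

theorem coeFn_ofReal_compLp (u : L2 n) :
    (Complex.ofRealCLM.compLp u : L2C n) =ᵐ[volume]
      fun x => (u x : ℂ) := by
  filter_upwards [ContinuousLinearMap.coeFn_compLp Complex.ofRealCLM u] with x hx
  simpa using hx

/-- Plancherel's theorem for first differences. -/
theorem lintegral_difference_sq (u : L2 n) (h : Rn n) :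
    ∫⁻ y : Rn n, ‖u (h + y) - u y‖ₑ ^ 2 =
      ∫⁻ ξ : Rn n, ‖fourierPhase h ξ - 1‖ₑ ^ 2 * ‖fourierL2 u ξ‖ₑ ^ 2 := by
  set v : L2C n := Complex.ofRealCLM.compLp u with hv
  have h1 : ‖(𝓕 (translate h v - v) : L2C n)‖ₑ = ‖translate h v - v‖ₑ := by
    rw [← ofReal_norm, Lp.norm_fourier_eq, ofReal_norm]
  rw [Lp.enorm_def, Lp.enorm_def] at h1
  have h2 := congrArg (· ^ 2) h1
  simp only [eLpNorm_two_sq] at h2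
  calc _ = ∫⁻ x, ‖(translate h v - v : L2C n) x‖ₑ ^ 2 := by
        refine lintegral_congr_ae ?_
        have h3 := (measurePreserving_add_left (volume : Measure (Rn n)) h
          ).quasiMeasurePreserving.ae_eq_comp (coeFn_ofReal_compLp u)
        filter_upwards [Lp.coeFn_sub (translate h v) v, coeFn_translate h v,
          coeFn_ofReal_compLp u, h3] with x a1 a2 a3 a4
        simp only [Function.comp_apply] at a4
        rw [a1, Pi.sub_apply, a2, hv, a3, a4, ← Complex.ofReal_sub, ← ofReal_norm,
          ← ofReal_norm, Complex.norm_real]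
    _ = _ := by
        rw [← h2]
        refine lintegral_congr_ae ?_
        have a2 : (𝓕 (translate h v - v) : L2C n) = 𝓕 (translate h v) - 𝓕 v :=
          (Lp.fourierTransformₗᵢ (Rn n) ℂ).map_sub _ _
        rw [a2]
        filter_upwards [Lp.coeFn_sub (𝓕 (translate h v)) (𝓕 v), fourier_translate h v]
          with ξ a1 a2
        rw [a1, Pi.sub_apply, a2, ← mul_pow, ← enorm_mul, sub_mul, one_mul, fourierL2, hv]

theorem lintegral_fourierL2_sq (u : L2 n) :
    ∫⁻ ξ, ‖fourierL2 u ξ‖ₑ ^ 2 = eLpNorm u 2 volume ^ 2 := by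
  rw [← eLpNorm_two_sq, fourierL2, ← Lp.enorm_def, ← ofReal_norm, Lp.norm_fourier_eq, ofReal_norm,
    Lp.enorm_def]
  congr 1
  refine eLpNorm_congr_norm_ae ?_
  filter_upwards [coeFn_ofReal_compLp u] with x hx
  rw [hx, Complex.norm_real]

/-- The Fourier symbol of the squared Gagliardo seminorm. -/
noncomputable def fracSymbol (s : ℝ) (ξ : Rn n) : ℝ≥0∞ :=
  ∫⁻ h : Rn n, fracKernel s h * ‖fourierPhase h ξ - 1‖ₑ ^ 2

/-- Plancherel for each difference followed by Tonelli. It reduces the comparison with `hsNorm` to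
pointwise bounds on the symbol. -/
theorem gagliardo_eq_lintegral_symbol (u : L2 n) :
    gagliardo s u = ∫⁻ ξ, fracSymbol s ξ * ‖fourierL2 u ξ‖ₑ ^ 2 := by
  have hm : Measurable (fourierL2 u) := (Lp.stronglyMeasurable _).measurable
  simp_rw [gagliardo, lintegral_difference_sq]
  calc _ = ∫⁻ h : Rn n, ∫⁻ ξ : Rn n,
        fracKernel s h * ‖fourierPhase h ξ - 1‖ₑ ^ 2 * ‖fourierL2 u ξ‖ₑ ^ 2 := by
        refine lintegral_congr fun h => ?_
        rw [← lintegral_const_mul _ (by fun_prop)]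
        simp_rw [mul_assoc]
    _ = ∫⁻ ξ : Rn n, ∫⁻ h : Rn n,
        fracKernel s h * ‖fourierPhase h ξ - 1‖ₑ ^ 2 * ‖fourierL2 u ξ‖ₑ ^ 2 := by
        refine lintegral_lintegral_swap (Measurable.aemeasurable ?_)
        simp only [Function.uncurry_def]
        fun_prop
    _ = _ := by
        refine lintegral_congr fun ξ => ?_
        rw [lintegral_mul_const _ (by fun_prop), fracSymbol]

theorem norm_fourierPhase_sub_one (h ξ : Rn n) :
    ‖fourierPhase h ξ - 1‖ = 2 * |Real.sin (Real.pi * ⟪h, ξ⟫)| := by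
  rw [fourierPhase, Real.fourierChar_apply, mul_comm, Complex.norm_exp_I_mul_ofReal_sub_one,
    norm_mul, Real.norm_eq_abs, Real.norm_eq_abs, abs_of_pos (by norm_num : (0 : ℝ) < 2)]
  congr 3; ring

theorem lintegral_comp_smul (f : Rn n → ℝ≥0∞) (hf : Measurable f) {r : ℝ} (hr : 0 < r) :
    ∫⁻ x, f (r • x) = ENNReal.ofReal ((r ^ n)⁻¹) * ∫⁻ x, f x := by
  have h := Measure.map_addHaar_smul (volume : Measure (Rn n)) hr.ne'
  rw [← lintegral_map hf (by fun_prop), h, lintegral_smul_measure, smul_eq_mul]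
  congr 2
  rw [abs_of_nonneg (by positivity)]; simp

/-- Substitute `h ↦ r h`: the homogeneity of the kernel gives `r^{n+2s}` and the Jacobian `r^{-n}`.
-/
theorem fracSymbol_smul (ξ : Rn n) {r : ℝ} (hr : 0 < r) :
    fracSymbol s (r • ξ) = ENNReal.ofReal (r ^ (2 * s)) * fracSymbol s ξ := by
  have h1 : ∀ h : Rn n, fracKernel s h * ‖fourierPhase h (r • ξ) - 1‖ₑ ^ 2 =
      ENNReal.ofReal (r ^ ((n : ℝ) + 2 * s)) *
        (fracKernel s (r • h) * ‖fourierPhase (r • h) ξ - 1‖ₑ ^ 2) := by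
    intro h
    have e : fourierPhase h (r • ξ) = fourierPhase (r • h) ξ := by
      simp only [fourierPhase, inner_smul_left, inner_smul_right, conj_trivial]
    rw [e, ← mul_assoc]
    congr 1
    rw [fracKernel, fracKernel, ← ENNReal.ofReal_mul (by positivity), norm_smul,
      Real.norm_of_nonneg hr.le, Real.mul_rpow hr.le (norm_nonneg _), ← mul_assoc,
      ← Real.rpow_add hr, add_neg_cancel, Real.rpow_zero, one_mul]
  simp_rw [fracSymbol, h1]
  rw [lintegral_const_mul _ (by fun_prop), lintegral_comp_smul
    (fun h => fracKernel s h * ‖fourierPhase h ξ - 1‖ₑ ^ 2) (by fun_prop) hr, ← mul_assoc,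
    ← ENNReal.ofReal_mul (by positivity)]
  congr 2
  rw [Real.rpow_add hr, Real.rpow_natCast]
  field_simp

theorem fracSymbol_eq (hs0 : 0 < s) (ξ : Rn n) :
    fracSymbol s ξ = ENNReal.ofReal (‖ξ‖ ^ (2 * s)) * fracSymbol s (‖ξ‖⁻¹ • ξ) := by
  rcases eq_or_ne ξ 0 with rfl | hξ
  · have : fracSymbol s (0 : Rn n) = 0 := by
      simp [fracSymbol, fourierPhase]
    rw [this, norm_zero, Real.zero_rpow (by positivity)]
    simp
  · have h0 : 0 < ‖ξ‖ := norm_pos_iff.mpr hξ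
    rw [← fracSymbol_smul _ h0, smul_smul, mul_inv_cancel₀ h0.ne', one_smul]

/-- By homogeneity it is enough to treat `|ξ| ≤ 1`. For `|h| < 1` use `|e^{2πi h·ξ} - 1| ≤ 2π|h|`,
for `|h| ≥ 1` the trivial bound `2`. Two-sided bounds suffice throughout, so the exact constant in
the symbol is not computed. -/
theorem exists_fracSymbol_le (hn : 1 ≤ n) (hs0 : 0 < s) (hs1 : s < 1) :
    ∃ C : ℝ≥0∞, C ≠ ⊤ ∧ ∀ ξ : Rn n, fracSymbol s ξ ≤ C * ENNReal.ofReal (‖ξ‖ ^ (2 * s)) := by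
  set C : ℝ≥0∞ := ENNReal.ofReal ((2 * Real.pi) ^ 2) *
      (∫⁻ z in Metric.ball (0 : Rn n) 1, fracKernel s z * ‖z‖ₑ ^ 2) +
    4 * ∫⁻ z in {z : Rn n | 1 ≤ ‖z‖}, fracKernel s z with hC
  have key : ∀ ξ : Rn n, ‖ξ‖ ≤ 1 → fracSymbol s ξ ≤ C := by
    intro ξ hξ
    have hcompl : (Metric.ball (0 : Rn n) 1)ᶜ = {z : Rn n | 1 ≤ ‖z‖} := by
      ext z; simp
    rw [fracSymbol, ← lintegral_add_compl _ (Metric.isOpen_ball (x := (0 : Rn n))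
      (ε := 1)).measurableSet, hC, hcompl, ← lintegral_const_mul _ (by fun_prop),
      ← lintegral_const_mul _ (by fun_prop)]
    refine add_le_add (lintegral_mono fun h => ?_) (lintegral_mono fun h => ?_)
    · dsimp only
      rw [mul_left_comm]
      refine mul_le_mul_right ?_ _
      rw [← ofReal_norm, ← ofReal_norm h, ← ENNReal.ofReal_pow (norm_nonneg _),
        ← ENNReal.ofReal_pow (norm_nonneg _), ← ENNReal.ofReal_mul (by positivity), ← mul_pow]
      refine ENNReal.ofReal_le_ofReal (pow_le_pow_left₀ (norm_nonneg _) ?_ _)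
      rw [norm_fourierPhase_sub_one, mul_assoc]
      refine mul_le_mul_of_nonneg_left ?_ (by norm_num)
      refine Real.abs_sin_le_abs.trans ?_
      rw [abs_mul, abs_of_pos Real.pi_pos]
      refine mul_le_mul_of_nonneg_left ?_ Real.pi_pos.le
      exact (abs_real_inner_le_norm _ _).trans (mul_le_of_le_one_right (norm_nonneg _) hξ)
    · dsimp only
      rw [mul_comm]
      refine mul_le_mul_left ?_ _
      rw [← ofReal_norm, ← ENNReal.ofReal_pow (norm_nonneg _)]
      refine ENNReal.ofReal_le_of_le_toReal ?_
      rw [norm_fourierPhase_sub_one]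
      have := Real.abs_sin_le_one (Real.pi * ⟪h, ξ⟫)
      simp only [ENNReal.toReal_ofNat]
      nlinarith [abs_nonneg (Real.sin (Real.pi * ⟪h, ξ⟫))]
  refine ⟨C, ?_, fun ξ => ?_⟩
  · exact ENNReal.add_ne_top.mpr ⟨ENNReal.mul_ne_top (by simp)
      (lintegral_fracKernel_mul_sq_ball hn hs1).ne, ENNReal.mul_ne_top (by simp)
      (lintegral_fracKernel_tail hs0 one_pos).ne⟩
  · rw [fracSymbol_eq hs0, mul_comm]
    refine mul_le_mul_left (key _ ?_) _
    rw [norm_smul, norm_inv, norm_norm]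
    exact inv_mul_le_one

theorem exists_le_fracSymbol (hs0 : 0 < s) :
    ∃ C : ℝ≥0∞, C ≠ ⊤ ∧ ∀ ξ : Rn n, ENNReal.ofReal (‖ξ‖ ^ (2 * s)) ≤ C * fracSymbol s ξ := by
  set c : ℝ≥0∞ := ENNReal.ofReal ((3 / 8 : ℝ) ^ (-((n : ℝ) + 2 * s))) * ENNReal.ofReal (1 / 4) *
    volume (Metric.ball (0 : Rn n) (1 / 8)) with hc
  have hc0 : c ≠ 0 := by
    refine mul_ne_zero (mul_ne_zero ?_ ?_) (Metric.measure_ball_pos _ _ (by norm_num)).ne'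
    · exact (ENNReal.ofReal_pos.mpr (by positivity)).ne'
    · exact (ENNReal.ofReal_pos.mpr (by positivity)).ne'
  have hct : c ≠ ⊤ := ENNReal.mul_ne_top
    (ENNReal.mul_ne_top ENNReal.ofReal_ne_top ENNReal.ofReal_ne_top) measure_ball_lt_top.ne
  have key : ∀ ξ : Rn n, ‖ξ‖ = 1 → c ≤ fracSymbol s ξ := by
    intro ξ hξ
    -- On this ball `h·ξ` lies in `[1/8, 3/8]`, so the phase stays away from `1`: Jordan's
    -- inequality gives `2 sin(π h·ξ) ≥ 4 h·ξ ≥ 1/2`, whose square is the `1/4` in `c`. Also `|h| ≤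
    -- 3/8`.
    set A := Metric.ball ((1 / 4 : ℝ) • ξ) (1 / 8) with hA
    calc c = ∫⁻ h in A, ENNReal.ofReal ((3 / 8 : ℝ) ^ (-((n : ℝ) + 2 * s))) *
          ENNReal.ofReal (1 / 4) := by
          rw [setLIntegral_const, hA, Measure.addHaar_ball_center]
      _ ≤ ∫⁻ h in A, fracKernel s h * ‖fourierPhase h ξ - 1‖ₑ ^ 2 := by
          refine setLIntegral_mono' Metric.isOpen_ball.measurableSet fun h hh => ?_
          rw [hA, mem_ball_iff_norm] at hh
          have h1 : |⟪h - (1 / 4 : ℝ) • ξ, ξ⟫| ≤ ‖h - (1 / 4 : ℝ) • ξ‖ := by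
            simpa [hξ] using abs_real_inner_le_norm (h - (1 / 4 : ℝ) • ξ) ξ
          rw [inner_sub_left, real_inner_smul_left, real_inner_self_eq_norm_sq, hξ, abs_le] at h1
          have h2 : ‖h‖ ≤ 3 / 8 := by
            have h3 := norm_sub_norm_le h ((1 / 4 : ℝ) • ξ)
            rw [norm_smul, hξ, Real.norm_of_nonneg (by norm_num)] at h3
            linarith
          have h4 : 1 / 8 ≤ ⟪h, ξ⟫ := by linarith [h1.1]
          have h5 : ⟪h, ξ⟫ ≤ 3 / 8 := by linarith [h1.2]
          have h0 : 0 < ‖h‖ := by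
            rw [norm_pos_iff]; rintro rfl; simp at h4; linarith
          refine mul_le_mul' ?_ ?_
          · refine ENNReal.ofReal_le_ofReal (Real.rpow_le_rpow_of_nonpos h0 h2 ?_)
            have : (0 : ℝ) ≤ n := n.cast_nonneg
            linarith
          · rw [← ofReal_norm, ← ENNReal.ofReal_pow (norm_nonneg _), norm_fourierPhase_sub_one]
            refine ENNReal.ofReal_le_ofReal ?_
            have hsin := Real.mul_le_sin (x := Real.pi * ⟪h, ξ⟫)
              (mul_nonneg Real.pi_pos.le (by linarith))
              (by nlinarith [Real.pi_pos])
            rw [← mul_assoc, div_mul_cancel₀ _ Real.pi_pos.ne'] at hsin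
            have := le_abs_self (Real.sin (Real.pi * ⟪h, ξ⟫))
            nlinarith
      _ ≤ _ := setLIntegral_le_lintegral _ _
  refine ⟨c⁻¹, ENNReal.inv_ne_top.mpr hc0, fun ξ => ?_⟩
  rcases eq_or_ne ξ 0 with rfl | hξ
  · rw [norm_zero, Real.zero_rpow (by positivity)]; simp
  rw [fracSymbol_eq hs0, mul_left_comm]
  refine le_mul_of_one_le_right' ?_
  rw [← ENNReal.inv_mul_cancel hc0 hct]
  refine mul_le_mul_right (key _ ?_) _
  rw [norm_smul, norm_inv, norm_norm, inv_mul_cancel₀ (norm_ne_zero_iff.mpr hξ)]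

/-! ### Comparison of the Bessel potential norm with the Gagliardo seminorm -/

theorem hsNorm_sq (u : L2 n) : hsNorm s u ^ 2 =
    ∫⁻ ξ, ENNReal.ofReal ((1 + (2 * Real.pi * ‖ξ‖) ^ 2) ^ s) * ‖fourierL2 u ξ‖ₑ ^ 2 := by
  rw [hsNorm, eLpNorm_two_sq]
  refine lintegral_congr fun ξ => ?_
  rw [enorm_smul, mul_pow, Real.enorm_of_nonneg (by positivity),
    ← ENNReal.ofReal_pow (by positivity), ← Real.rpow_natCast, ← Real.rpow_mul (by positivity)]
  congr 4; push_cast; ring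

theorem eLpNorm_le_hsNorm (hs0 : 0 < s) (u : L2 n) : eLpNorm u 2 volume ≤ hsNorm s u := by
  refine (ENNReal.pow_le_pow_left_iff (n := 2) (by norm_num)).mp ?_
  rw [hsNorm_sq, ← lintegral_fourierL2_sq]
  refine lintegral_mono fun ξ => le_mul_of_one_le_left' ?_
  rw [ENNReal.one_le_ofReal]
  exact Real.one_le_rpow (by nlinarith [sq_nonneg (2 * Real.pi * ‖ξ‖)]) hs0.le

theorem exists_gagliardo_le_hsNorm (hn : 1 ≤ n) (hs0 : 0 < s) (hs1 : s < 1) :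
    ∃ C : ℝ≥0∞, C ≠ ⊤ ∧ ∀ u : L2 n, gagliardo s u ≤ C * hsNorm s u ^ 2 := by
  obtain ⟨C, hC, h⟩ := exists_fracSymbol_le hn hs0 hs1
  refine ⟨C, hC, fun u => ?_⟩
  rw [gagliardo_eq_lintegral_symbol, hsNorm_sq, ← lintegral_const_mul' _ _ hC]
  refine lintegral_mono fun ξ => ?_
  rw [← mul_assoc]
  refine mul_le_mul_left ((h ξ).trans (mul_le_mul_right (ENNReal.ofReal_le_ofReal ?_) _)) _
  rw [Real.rpow_mul (norm_nonneg _)]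
  refine Real.rpow_le_rpow (by positivity) ?_ hs0.le
  have h1 : (1 : ℝ) ≤ (2 * Real.pi) ^ 2 := by nlinarith [Real.pi_gt_three]
  rw [mul_pow, Real.rpow_two]
  nlinarith [sq_nonneg ‖ξ‖]

theorem exists_hsNorm_le (hs0 : 0 < s) :
    ∃ C : ℝ≥0∞, C ≠ ⊤ ∧ ∀ u : L2 n,
      hsNorm s u ^ 2 ≤ C * (eLpNorm u 2 volume ^ 2 + gagliardo s u) := by
  obtain ⟨C, hC, h⟩ := exists_le_fracSymbol (n := n) hs0
  set A : ℝ≥0∞ := ENNReal.ofReal ((1 + (2 * Real.pi) ^ 2) ^ s) with hA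
  have hAt : A ≠ ⊤ := ENNReal.ofReal_ne_top
  refine ⟨A * (1 + C), ENNReal.mul_ne_top hAt (by simp [hC]), fun u => ?_⟩
  have hm : Measurable (fourierL2 u) := (Lp.stronglyMeasurable _).measurable
  have hbound : ∀ ξ : Rn n, ENNReal.ofReal ((1 + (2 * Real.pi * ‖ξ‖) ^ 2) ^ s) ≤
      A * (1 + ENNReal.ofReal (‖ξ‖ ^ (2 * s))) := by
    intro ξ
    rw [← ENNReal.ofReal_one, ← ENNReal.ofReal_add zero_le_one (by positivity),
      ← ENNReal.ofReal_mul (by positivity)]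
    refine ENNReal.ofReal_le_ofReal ?_
    -- The maximum is used because its `s`-th power is at most `1 + ‖ξ‖ ^ (2 * s)`, which separates
    -- the `L²` part from the seminorm.
    have hmax : 1 + (2 * Real.pi * ‖ξ‖) ^ 2 ≤ (1 + (2 * Real.pi) ^ 2) * max 1 (‖ξ‖ ^ 2) := by
      have m1 := le_max_left 1 (‖ξ‖ ^ 2)
      have m2 := le_max_right 1 (‖ξ‖ ^ 2)
      rw [mul_pow]
      nlinarith [sq_nonneg (2 * Real.pi)]
    refine (Real.rpow_le_rpow (by positivity) hmax hs0.le).trans ?_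
    rw [Real.mul_rpow (by positivity) (by positivity)]
    refine mul_le_mul_of_nonneg_left ?_ (by positivity)
    have hp : (0 : ℝ) ≤ ‖ξ‖ ^ (2 * s) := by positivity
    rcases max_cases 1 (‖ξ‖ ^ 2) with ⟨e, _⟩ | ⟨e, _⟩
    · rw [e, Real.one_rpow]; linarith
    · rw [e, ← Real.rpow_two, ← Real.rpow_mul (norm_nonneg _)]; linarith
  calc hsNorm s u ^ 2 ≤ ∫⁻ ξ, A * (‖fourierL2 u ξ‖ₑ ^ 2 +
        C * (fracSymbol s ξ * ‖fourierL2 u ξ‖ₑ ^ 2)) := by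
        rw [hsNorm_sq]
        refine lintegral_mono fun ξ => ?_
        calc _ ≤ A * (1 + ENNReal.ofReal (‖ξ‖ ^ (2 * s))) * ‖fourierL2 u ξ‖ₑ ^ 2 := by
              gcongr; exact hbound ξ
          _ ≤ A * (1 + C * fracSymbol s ξ) * ‖fourierL2 u ξ‖ₑ ^ 2 := by gcongr; exact h ξ
          _ = _ := by ring
    _ = A * (eLpNorm u 2 volume ^ 2 + C * gagliardo s u) := by
        rw [lintegral_const_mul' _ _ hAt, lintegral_add_left (by fun_prop),
          lintegral_const_mul' _ _ hC, lintegral_fourierL2_sq, gagliardo_eq_lintegral_symbol]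
    _ ≤ _ := by
        rw [mul_assoc]
        gcongr
        calc _ ≤ (1 + C) * eLpNorm u 2 volume ^ 2 + (1 + C) * gagliardo s u :=
              add_le_add (le_mul_of_one_le_left' le_self_add) (mul_le_mul_left le_add_self _)
          _ = _ := by ring

/-! ### The spaces `H^s` and `H̃^s(Ω)` -/

/-- The `L²` part is finite from the start, so only the seminorm matters. From here on the argument
can work with kernel integrals instead of the Fourier transform. -/
theorem memHs_iff_gagliardo_lt_top (hn : 1 ≤ n) (hs0 : 0 < s) (hs1 : s < 1) (u : L2 n) :
    MemHs s u ↔ gagliardo s u < ⊤ := by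
  constructor
  · intro h
    obtain ⟨C, hC, hle⟩ := exists_gagliardo_le_hsNorm hn hs0 hs1
    exact (hle u).trans_lt (ENNReal.mul_lt_top hC.lt_top (ENNReal.pow_lt_top h))
  · intro h
    obtain ⟨C, hC, hle⟩ := exists_hsNorm_le (n := n) hs0
    have h2 : hsNorm s u ^ 2 < ⊤ := (hle u).trans_lt (ENNReal.mul_lt_top hC.lt_top
      (ENNReal.add_lt_top.mpr ⟨ENNReal.pow_lt_top (Lp.memLp u).2, h⟩))
    by_contra h3
    rw [MemHs, not_lt, top_le_iff] at h3
    simp [h3] at h2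

/-- `fourierL2` as a linear map. -/
noncomputable def fourierL2ₗ : L2 n →ₗ[ℝ] L2C n :=
  ((Lp.fourierTransformₗᵢ (Rn n) ℂ).toLinearEquiv.toLinearMap.restrictScalars ℝ) ∘ₗ
    (Complex.ofRealCLM.compLpₗ 2 (volume : Measure (Rn n)))

theorem hsNorm_add_le (u v : L2 n) : hsNorm s (u + v) ≤ hsNorm s u + hsNorm s v := by
  have hm : ∀ w : L2 n, AEStronglyMeasurable (fun ξ : Rn n =>
      ((1 + (2 * Real.pi * ‖ξ‖) ^ 2) ^ (s / 2) : ℝ) • fourierL2 w ξ) volume := fun w => by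
    have hw : Measurable fun ξ : Rn n => ((1 + (2 * Real.pi * ‖ξ‖) ^ 2) ^ (s / 2) : ℝ) := by fun_prop
    exact hw.aestronglyMeasurable.smul (Lp.aestronglyMeasurable _)
  refine le_trans (le_of_eq ?_) (eLpNorm_add_le (hm u) (hm v) (by norm_num))
  refine eLpNorm_congr_ae ?_
  have h : fourierL2 (u + v) = fourierL2 u + fourierL2 v := map_add fourierL2ₗ u v
  rw [h]
  filter_upwards [Lp.coeFn_add (fourierL2 u) (fourierL2 v)] with ξ hξ
  rw [hξ, Pi.add_apply, Pi.add_apply, smul_add]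

theorem hsNorm_smul (c : ℝ) (u : L2 n) : hsNorm s (c • u) = ‖c‖ₑ * hsNorm s u := by
  have h : fourierL2 (c • u) = c • fourierL2 u := map_smul fourierL2ₗ c u
  rw [hsNorm, hsNorm, ← eLpNorm_const_smul, h]
  refine eLpNorm_congr_ae ?_
  filter_upwards [Lp.coeFn_smul c (fourierL2 u)] with ξ hξ
  rw [hξ, Pi.smul_apply, Pi.smul_apply, smul_comm]

theorem hsNorm_zero : hsNorm s (0 : L2 n) = 0 := by
  simpa using hsNorm_smul (s := s) (0 : ℝ) (0 : L2 n)

theorem coeFn_testL2 {U : Opens (Rn n)} (φ : 𝓓(U, ℝ)) : testL2 φ =ᵐ[volume] φ :=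
  MemLp.coeFn_toLp _

theorem testL2_add {U : Opens (Rn n)} (φ ψ : 𝓓(U, ℝ)) :
    testL2 (φ + ψ) = testL2 φ + testL2 ψ := by
  refine Lp.ext ?_
  filter_upwards [coeFn_testL2 φ, coeFn_testL2 ψ, coeFn_testL2 (φ + ψ),
    Lp.coeFn_add (testL2 φ) (testL2 ψ)] with x h1 h2 h3 h4
  rw [h3, h4, Pi.add_apply, h1, h2]; rfl

theorem testL2_smul {U : Opens (Rn n)} (c : ℝ) (φ : 𝓓(U, ℝ)) :
    testL2 (c • φ) = c • testL2 φ := by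
  refine Lp.ext ?_
  filter_upwards [coeFn_testL2 φ, coeFn_testL2 (c • φ), Lp.coeFn_smul c (testL2 φ)]
    with x h1 h2 h3
  rw [h2, h3, Pi.smul_apply, h1]; rfl

/-- `H^s(ℝⁿ)` as a subspace of `L²(ℝⁿ)`. -/
noncomputable def hsSubmodule (n : ℕ) (s : ℝ) : Submodule ℝ (L2 n) where
  carrier := {u | MemHs s u}
  add_mem' {u v} hu hv := (hsNorm_add_le u v).trans_lt (ENNReal.add_lt_top.mpr ⟨hu, hv⟩)
  zero_mem' := by
    change hsNorm s (0 : L2 n) < ⊤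
    simp [hsNorm_zero]
  smul_mem' c u hu := by
    change hsNorm s (c • u) < ⊤
    rw [hsNorm_smul]
    exact ENNReal.mul_lt_top (by simp) hu

/-- `H̃^s(Ω)` as a subspace of `L²(ℝⁿ)`. -/
noncomputable def hsTildeSubmodule (Ω : Opens (Rn n)) (s : ℝ) : Submodule ℝ (L2 n) where
  carrier := {u | MemHsTilde Ω s u}
  add_mem' {u v} hu hv := by
    refine ⟨(hsSubmodule n s).add_mem hu.1 hv.1, fun ε hε => ?_⟩
    obtain ⟨φ, hφ⟩ := hu.2 (ε / 2) (ENNReal.half_pos hε.ne')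
    obtain ⟨ψ, hψ⟩ := hv.2 (ε / 2) (ENNReal.half_pos hε.ne')
    refine ⟨φ + ψ, ?_⟩
    rw [testL2_add, add_sub_add_comm]
    refine (hsNorm_add_le _ _).trans_lt ?_
    rw [← ENNReal.add_halves ε]
    exact ENNReal.add_lt_add hφ hψ
  zero_mem' := by
    refine ⟨(hsSubmodule n s).zero_mem, fun ε hε => ⟨0, ?_⟩⟩
    have h := testL2_smul (0 : ℝ) (0 : 𝓓(Ω, ℝ))
    rw [zero_smul, zero_smul] at h
    rw [h, sub_zero, hsNorm_zero]
    exact hε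
  smul_mem' c u hu := by
    refine ⟨(hsSubmodule n s).smul_mem c hu.1, fun ε hε => ?_⟩
    -- Dividing by `‖c‖ₑ + 1` covers `c = 0` and yields a strict inequality.
    obtain ⟨φ, hφ⟩ := hu.2 (ε / (‖c‖ₑ + 1)) (ENNReal.div_pos hε.ne' (by simp))
    refine ⟨c • φ, ?_⟩
    rw [testL2_smul, ← smul_sub, hsNorm_smul]
    rcases eq_or_ne ε ⊤ with rfl | ht
    · exact ENNReal.mul_lt_top (by simp) hφ.lt_top
    calc _ ≤ ‖c‖ₑ * (ε / (‖c‖ₑ + 1)) := mul_le_mul_right hφ.le _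
      _ < (‖c‖ₑ + 1) * (ε / (‖c‖ₑ + 1)) := by
        refine ENNReal.mul_lt_mul_left (ENNReal.div_pos hε.ne' (by simp)).ne'
          (ENNReal.div_lt_top ht (by simp)).ne ?_
        exact ENNReal.lt_add_right (by simp) (by simp)
      _ = ε := ENNReal.mul_div_cancel (by simp) (by simp)

theorem memHsTilde_of_approx {Ω : Opens (Rn n)} {u : L2 n} (hu : MemHs s u)
    (h : ∀ ε : ℝ≥0∞, 0 < ε → ∃ v, MemHsTilde Ω s v ∧ hsNorm s (u - v) < ε) :
    MemHsTilde Ω s u := by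
  refine ⟨hu, fun ε hε => ?_⟩
  obtain ⟨v, hv, huv⟩ := h (ε / 2) (ENNReal.half_pos hε.ne')
  obtain ⟨φ, hφ⟩ := hv.2 (ε / 2) (ENNReal.half_pos hε.ne')
  refine ⟨φ, ?_⟩
  rw [← sub_add_sub_cancel u v (testL2 φ)]
  refine (hsNorm_add_le _ _).trans_lt ?_
  rw [← ENNReal.add_halves ε]
  exact ENNReal.add_lt_add huv hφ

/-- The Fourier transform of a test function is Schwartz, and the Bessel weight has temperate
growth, so the weighted transform is again Schwartz and lies in `L²`. -/
theorem memHs_testL2 {U : Opens (Rn n)} (φ : 𝓓(U, ℝ)) : MemHs s (testL2 φ) := by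
  have hc : HasCompactSupport (fun x => (φ x : ℂ)) :=
    φ.hasCompactSupport.comp_left (g := fun t : ℝ => (t : ℂ)) (by simp)
  have hd : ContDiff ℝ ((⊤ : ℕ∞) : WithTop ℕ∞) (fun x => (φ x : ℂ)) :=
    Complex.ofRealCLM.contDiff.comp φ.contDiff
  set f : 𝓢(Rn n, ℂ) := hc.toSchwartzMap hd with hf
  have h1 : Complex.ofRealCLM.compLp (testL2 φ) = f.toLp 2 volume := by
    refine Lp.ext ?_
    filter_upwards [coeFn_ofReal_compLp (testL2 φ), coeFn_testL2 φ, f.coeFn_toLp 2 volume]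
      with x a1 a2 a3
    rw [a1, a2, a3]; rfl
  have hg : (fun ξ : Rn n => (1 + (2 * Real.pi * ‖ξ‖) ^ 2) ^ (s / 2)).HasTemperateGrowth := by
    have h2 := (Function.hasTemperateGrowth_one_add_norm_sq_rpow (Rn n) (s / 2)).comp
      (((2 * Real.pi) • ContinuousLinearMap.id ℝ (Rn n)).hasTemperateGrowth)
    have e : (fun ξ : Rn n => (1 + (2 * Real.pi * ‖ξ‖) ^ 2) ^ (s / 2)) =
        (fun x : Rn n => (1 + ‖x‖ ^ 2) ^ (s / 2)) ∘
          ((2 * Real.pi) • ContinuousLinearMap.id ℝ (Rn n)) := by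
      funext ξ
      simp [norm_smul, abs_of_pos Real.pi_pos]
    rw [e]
    exact h2
  have h3 := (SchwartzMap.smulLeftCLM ℂ (fun ξ : Rn n => (1 + (2 * Real.pi * ‖ξ‖) ^ 2) ^ (s / 2))
    (𝓕 f)).memLp 2 volume
  rw [MemHs, hsNorm, fourierL2, h1, SchwartzMap.toLp_fourier_eq]
  refine lt_of_eq_of_lt (eLpNorm_congr_ae ?_) h3.2
  filter_upwards [(𝓕 f).coeFn_toLp 2 volume] with ξ hξ
  rw [SchwartzMap.smulLeftCLM_apply_apply hg, hξ]

/-- Outside `Ω` the function agrees with `u - φ` for every test function `φ` on `Ω`, and the `L²`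
norm of this difference can be made arbitrarily small. -/
theorem MemHsTilde.ae_eq_zero (hs0 : 0 < s) {Ω : Opens (Rn n)} {u : L2 n}
    (hu : MemHsTilde Ω s u) : ∀ᵐ x, x ∉ (Ω : Set (Rn n)) → u x = 0 := by
  have h : ∫⁻ x in (Ω : Set (Rn n))ᶜ, ‖u x‖ₑ ^ 2 = 0 := by
    refine le_antisymm (le_of_forall_gt fun ε hε => ?_) zero_le
    obtain ⟨δ, hδ, hδε⟩ : ∃ δ : ℝ≥0∞, 0 < δ ∧ δ ^ 2 ≤ ε := by
      refine ⟨min ε 1, lt_min hε one_pos, ?_⟩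
      rw [sq]
      exact (mul_le_mul' (min_le_left _ _) (min_le_right _ _)).trans (by simp)
    obtain ⟨φ, hφ⟩ := hu.2 δ hδ
    calc _ = ∫⁻ x in (Ω : Set (Rn n))ᶜ, ‖(u - testL2 φ : L2 n) x‖ₑ ^ 2 := by
          refine setLIntegral_congr_fun_ae Ω.isOpen.measurableSet.compl ?_
          filter_upwards [Lp.coeFn_sub u (testL2 φ), coeFn_testL2 φ] with x h1 h2 hx
          have h3 : φ x = 0 := image_eq_zero_of_notMem_tsupport fun hm => hx (φ.tsupport_subset hm)
          rw [h1, Pi.sub_apply, h2, h3, sub_zero]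
      _ ≤ eLpNorm (u - testL2 φ : L2 n) 2 volume ^ 2 := by
          rw [eLpNorm_two_sq]; exact setLIntegral_le_lintegral _ _
      _ ≤ hsNorm s (u - testL2 φ) ^ 2 := pow_le_pow_left' (eLpNorm_le_hsNorm hs0 _) 2
      _ < δ ^ 2 := ENNReal.pow_lt_pow_left (by norm_num) hφ
      _ ≤ ε := hδε
  have hm := measurable_coe_L2 u
  rw [lintegral_eq_zero_iff (by fun_prop), Filter.EventuallyEq,
    ae_restrict_iff' Ω.isOpen.measurableSet.compl] at h
  filter_upwards [h] with x hx hxΩ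
  simpa using hx hxΩ

/-- The fractional Poincaré inequality on sets that are bounded in one direction. -/
theorem exists_eLpNorm_le_gagliardo (hs0 : 0 < s) {Ω : Opens (Rn n)}
    (hΩ : BoundedInOneDirection (Ω : Set (Rn n))) :
    ∃ C : ℝ≥0∞, C ≠ ⊤ ∧ ∀ u : L2 n, MemHsTilde Ω s u →
      eLpNorm u 2 volume ^ 2 ≤ C * gagliardo s u := by
  obtain ⟨v, hv, a, b, hab⟩ := hΩ
  -- The width must be positive even when `a = b`, or when `b < a` and `Ω` is empty.
  set ε : ℝ := |b - a| + 1 with hε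
  have hε0 : 0 < ε := by positivity
  set c : ℝ≥0∞ := ENNReal.ofReal ((4 * ε) ^ (-((n : ℝ) + 2 * s)) * ε ^ n) *
    volume (Metric.ball (0 : Rn n) 1) with hc
  have hc0 : c ≠ 0 := mul_ne_zero (ENNReal.ofReal_pos.mpr (by positivity)).ne'
    (Metric.measure_ball_pos _ _ one_pos).ne'
  have hct : c ≠ ⊤ := ENNReal.mul_ne_top ENNReal.ofReal_ne_top measure_ball_lt_top.ne
  refine ⟨c⁻¹, ENNReal.inv_ne_top.mpr hc0, fun u hu => ?_⟩
  have h := eLpNorm_le_gagliardo_of_strip hs0 (u := u) hv (a := a) hε0 ?_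
  · rw [eLpNorm_two_sq]
    rw [← ENNReal.div_eq_inv_mul, ENNReal.le_div_iff_mul_le (Or.inl hc0) (Or.inl hct), mul_comm]
    exact h
  · filter_upwards [hu.ae_eq_zero hs0] with x hx hxS
    refine hx fun hxΩ => hxS ?_
    have := hab x hxΩ
    exact ⟨this.1, by linarith [this.2, le_abs_self (b - a)]⟩

variable {γ : Rn n → ℝ}

/-! ### The conductivity form -/

theorem ae_prod_of_ae {P Q : Rn n → Prop} (hP : ∀ᵐ x, P x) (hQ : ∀ᵐ x, Q x) :
    ∀ᵐ p : Rn n × Rn n, P p.1 ∧ Q p.2 :=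
  (Measure.quasiMeasurePreserving_fst.ae hP).and (Measure.quasiMeasurePreserving_snd.ae hQ)

theorem IsConductivity.exists_bounds (hγ : IsConductivity γ) :
    ∃ a M : ℝ, 0 < a ∧ 0 < M ∧ ∀ᵐ x, a ≤ γ x ∧ γ x ≤ M := by
  obtain ⟨hL, a, ha, hae⟩ := hγ
  refine ⟨a, (eLpNorm γ ⊤ volume).toReal + 1, ha, by positivity, ?_⟩
  have h2 : ∀ᵐ x, ‖γ x‖ₑ ≤ eLpNorm γ ⊤ volume := by
    rw [eLpNorm_exponent_top]; exact ae_le_eLpNormEssSup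
  filter_upwards [hae, h2] with x hx hx2
  have h3 := ENNReal.toReal_mono hL.2.ne hx2
  rw [toReal_enorm, Real.norm_eq_abs] at h3
  exact ⟨hx, by linarith [le_abs_self (γ x)]⟩

theorem IsConductivity.aemeasurable (hγ : IsConductivity γ) : AEMeasurable γ :=
  hγ.1.1.aemeasurable

theorem sqrt_mul_sqrt_bounds {a M x y : ℝ} (ha : 0 < a) (hx : a ≤ x ∧ x ≤ M)
    (hy : a ≤ y ∧ y ≤ M) : a ≤ √x * √y ∧ √x * √y ≤ M := by
  have hM : 0 < M := ha.trans_le (hx.1.trans hx.2)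
  constructor
  · calc a = √a * √a := (Real.mul_self_sqrt ha.le).symm
      _ ≤ √x * √y := mul_le_mul (Real.sqrt_le_sqrt hx.1) (Real.sqrt_le_sqrt hy.1)
          (Real.sqrt_nonneg _) (Real.sqrt_nonneg _)
  · calc √x * √y ≤ √M * √M := mul_le_mul (Real.sqrt_le_sqrt hx.2) (Real.sqrt_le_sqrt hy.2)
          (Real.sqrt_nonneg _) (Real.sqrt_nonneg _)
      _ = M := Real.mul_self_sqrt hM.le

/-- The square root of the weight `γ^{1/2}(x) γ^{1/2}(y)`. -/
noncomputable def condWeight (γ : Rn n → ℝ) (p : Rn n × Rn n) : ℝ := √(√(γ p.1) * √(γ p.2))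

theorem condWeight_mul_self (γ : Rn n → ℝ) (p : Rn n × Rn n) :
    condWeight γ p * condWeight γ p = √(γ p.1) * √(γ p.2) :=
  Real.mul_self_sqrt (by positivity)

theorem enorm_condWeight_sq (γ : Rn n → ℝ) (p : Rn n × Rn n) :
    ‖condWeight γ p‖ₑ ^ 2 = ENNReal.ofReal (√(γ p.1) * √(γ p.2)) := by
  rw [← condWeight_mul_self, sq, ← enorm_mul, Real.enorm_of_nonneg (mul_self_nonneg _)]

theorem IsConductivity.aemeasurable_condWeight (hγ : IsConductivity γ) :
    AEMeasurable (condWeight γ) := by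
  have h1 : AEMeasurable (fun p : Rn n × Rn n => γ p.1) :=
    hγ.aemeasurable.comp_quasiMeasurePreserving Measure.quasiMeasurePreserving_fst
  have h2 : AEMeasurable (fun p : Rn n × Rn n => γ p.2) :=
    hγ.aemeasurable.comp_quasiMeasurePreserving Measure.quasiMeasurePreserving_snd
  exact (h1.sqrt.mul h2.sqrt).sqrt

/-- The fractional difference quotient, weighted so that its `L²` inner products are the values of
the conductivity form. -/
noncomputable def condQuot (s : ℝ) (γ : Rn n → ℝ) (u : Rn n → ℝ) (p : Rn n × Rn n) : ℝ :=
  condWeight γ p * fracQuot s u p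

theorem condForm_eq (u v : L2 n) :
    condForm s γ u v = ∫ p, condQuot s γ u p * condQuot s γ v p := by
  refine integral_congr_ae (Eventually.of_forall fun p => ?_)
  dsimp only
  rw [inner_fracGrad, ← condWeight_mul_self, condQuot, condQuot]
  ring

theorem fracQuot_congr {u v : Rn n → ℝ} (h : u =ᵐ[volume] v) :
    fracQuot s u =ᵐ[volume] fracQuot s v := by
  filter_upwards [ae_prod_of_ae h h] with p hp
  rw [fracQuot, fracQuot, hp.1, hp.2]

theorem condQuot_congr {u v : Rn n → ℝ} (h : u =ᵐ[volume] v) :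
    condQuot s γ u =ᵐ[volume] condQuot s γ v := by
  filter_upwards [fracQuot_congr (s := s) h] with p hp
  rw [condQuot, condQuot, hp]

theorem condQuot_add (u v : L2 n) : condQuot s γ (u + v : L2 n) =ᵐ[volume]
    fun p => condQuot s γ u p + condQuot s γ v p := by
  filter_upwards [condQuot_congr (s := s) (γ := γ) (Lp.coeFn_add u v)] with p hp
  rw [hp]; simp only [condQuot, fracQuot, Pi.add_apply]; ring

theorem condQuot_sub (u v : L2 n) : condQuot s γ (u - v : L2 n) =ᵐ[volume]
    fun p => condQuot s γ u p - condQuot s γ v p := by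
  filter_upwards [condQuot_congr (s := s) (γ := γ) (Lp.coeFn_sub u v)] with p hp
  rw [hp]; simp only [condQuot, fracQuot, Pi.sub_apply]; ring

theorem condQuot_smul (c : ℝ) (u : L2 n) : condQuot s γ (c • u : L2 n) =ᵐ[volume]
    fun p => c * condQuot s γ u p := by
  filter_upwards [condQuot_congr (s := s) (γ := γ) (Lp.coeFn_smul c u)] with p hp
  rw [hp]; simp only [condQuot, fracQuot, Pi.smul_apply, smul_eq_mul]; ring

theorem aestronglyMeasurable_condQuot (hγ : IsConductivity γ) (u : L2 n) :
    AEStronglyMeasurable (condQuot s γ u) volume :=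
  (hγ.aemeasurable_condWeight.mul
    (measurable_fracQuot (measurable_coe_L2 u)).aemeasurable).aestronglyMeasurable

theorem lintegral_condQuot_sq_le (hs0 : 0 < s) (hs1 : s < 1) {M : ℝ} (hM : ∀ᵐ p : Rn n × Rn n,
    √(γ p.1) * √(γ p.2) ≤ M) (u : L2 n) : ∫⁻ p, ‖condQuot s γ u p‖ₑ ^ 2 ≤
      ENNReal.ofReal M * (ENNReal.ofReal (fracConst n s / 2) * gagliardo s u) := by
  rw [← lintegral_fracQuot_sq hs0 hs1 (measurable_coe_L2 u),
    ← lintegral_const_mul' _ _ ENNReal.ofReal_ne_top]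
  refine lintegral_mono_ae ?_
  filter_upwards [hM] with p hp
  rw [condQuot, enorm_mul, mul_pow, enorm_condWeight_sq]
  exact mul_le_mul_left (ENNReal.ofReal_le_ofReal hp) _

theorem le_lintegral_condQuot_sq (hs0 : 0 < s) (hs1 : s < 1) {a : ℝ} (ha : ∀ᵐ p : Rn n × Rn n,
    a ≤ √(γ p.1) * √(γ p.2)) (u : L2 n) :
    ENNReal.ofReal a * (ENNReal.ofReal (fracConst n s / 2) * gagliardo s u) ≤
      ∫⁻ p, ‖condQuot s γ u p‖ₑ ^ 2 := by
  rw [← lintegral_fracQuot_sq hs0 hs1 (measurable_coe_L2 u),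
    ← lintegral_const_mul' _ _ ENNReal.ofReal_ne_top]
  refine lintegral_mono_ae ?_
  filter_upwards [ha] with p hp
  rw [condQuot, enorm_mul, mul_pow, enorm_condWeight_sq]
  exact mul_le_mul_left (ENNReal.ofReal_le_ofReal hp) _

/-- Ellipticity. Together with the Poincaré inequality it makes the conductivity form coercive on
`H̃^s(Ω)`. -/
theorem IsConductivity.exists_gagliardo_le (hs0 : 0 < s) (hs1 : s < 1) (hγ : IsConductivity γ) :
    ∃ C : ℝ≥0∞, C ≠ ⊤ ∧ ∀ u : L2 n, gagliardo s u ≤ C * ∫⁻ p, ‖condQuot s γ u p‖ₑ ^ 2 := by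
  obtain ⟨a, M, ha, -, hb⟩ := hγ.exists_bounds
  have hc := fracConst_pos (n := n) hs0 hs1
  set c : ℝ≥0∞ := ENNReal.ofReal a * ENNReal.ofReal (fracConst n s / 2) with hcdef
  have hc0 : c ≠ 0 := mul_ne_zero (ENNReal.ofReal_pos.mpr ha).ne'
    (ENNReal.ofReal_pos.mpr (by positivity)).ne'
  have hct : c ≠ ⊤ := ENNReal.mul_ne_top ENNReal.ofReal_ne_top ENNReal.ofReal_ne_top
  refine ⟨c⁻¹, ENNReal.inv_ne_top.mpr hc0, fun u => ?_⟩
  rw [← ENNReal.div_eq_inv_mul, ENNReal.le_div_iff_mul_le (Or.inl hc0) (Or.inl hct), mul_comm,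
    hcdef, mul_assoc]
  refine le_lintegral_condQuot_sq hs0 hs1 ?_ u
  filter_upwards [ae_prod_of_ae hb hb] with p hp
  exact (sqrt_mul_sqrt_bounds ha hp.1 hp.2).1

theorem memLp_condQuot (hn : 1 ≤ n) (hs0 : 0 < s) (hs1 : s < 1) (hγ : IsConductivity γ) {u : L2 n}
    (hu : MemHs s u) : MemLp (condQuot s γ u) 2 volume := by
  refine ⟨aestronglyMeasurable_condQuot hγ u, ?_⟩
  obtain ⟨a, M, ha, -, hb⟩ := hγ.exists_bounds
  have h := lintegral_condQuot_sq_le (n := n) (γ := γ) (M := M) hs0 hs1 (by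
    filter_upwards [ae_prod_of_ae hb hb] with p hp
    exact (sqrt_mul_sqrt_bounds ha hp.1 hp.2).2) u
  rw [← eLpNorm_two_sq] at h
  have h2 : eLpNorm (condQuot s γ u) 2 volume ^ 2 < ⊤ := h.trans_lt
    (ENNReal.mul_lt_top (by simp) (ENNReal.mul_lt_top (by simp)
      ((memHs_iff_gagliardo_lt_top hn hs0 hs1 u).mp hu)))
  by_contra h3
  rw [not_lt, top_le_iff] at h3
  simp [h3] at h2

theorem memHs_of_memLp_condQuot (hn : 1 ≤ n) (hs0 : 0 < s) (hs1 : s < 1) (hγ : IsConductivity γ)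
    {u : L2 n} (hu : MemLp (condQuot s γ u) 2 volume) : MemHs s u := by
  obtain ⟨C, hC, h⟩ := hγ.exists_gagliardo_le hs0 hs1
  rw [memHs_iff_gagliardo_lt_top hn hs0 hs1]
  refine (h u).trans_lt (ENNReal.mul_lt_top hC.lt_top ?_)
  rw [← eLpNorm_two_sq]
  exact ENNReal.pow_lt_top hu.2

theorem integrable_condQuot_mul (hn : 1 ≤ n) (hs0 : 0 < s) (hs1 : s < 1) (hγ : IsConductivity γ)
    {u v : L2 n} (hu : MemHs s u) (hv : MemHs s v) :
    Integrable fun p => condQuot s γ u p * condQuot s γ v p :=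
  (memLp_condQuot hn hs0 hs1 hγ hu).integrable_mul (memLp_condQuot hn hs0 hs1 hγ hv)

theorem condForm_add_left (hn : 1 ≤ n) (hs0 : 0 < s) (hs1 : s < 1) (hγ : IsConductivity γ)
    {u v w : L2 n} (hu : MemHs s u) (hv : MemHs s v) (hw : MemHs s w) :
    condForm s γ (u + v) w = condForm s γ u w + condForm s γ v w := by
  simp only [condForm_eq]
  rw [← integral_add (integrable_condQuot_mul hn hs0 hs1 hγ hu hw)
    (integrable_condQuot_mul hn hs0 hs1 hγ hv hw)]
  refine integral_congr_ae ?_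
  filter_upwards [condQuot_add (s := s) (γ := γ) u v] with p hp
  rw [hp]; ring

theorem condForm_comm (u v : L2 n) : condForm s γ u v = condForm s γ v u := by
  simp only [condForm_eq, mul_comm]

/-! ### Existence of weak solutions -/

/-- The weighted difference quotients of the functions in `H̃^s(Ω)`, as a subspace of
`L²(ℝ²ⁿ)`. -/
noncomputable def condQuotRange (γ : Rn n → ℝ) (Ω : Opens (Rn n)) (s : ℝ) :
    Submodule ℝ (Lp ℝ 2 (volume : Measure (Rn n × Rn n))) where
  carrier := {z | ∃ w : L2 n, MemHsTilde Ω s w ∧ z =ᵐ[volume] condQuot s γ w}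
  add_mem' := by
    rintro z z' ⟨w, hw, hz⟩ ⟨w', hw', hz'⟩
    refine ⟨w + w', (hsTildeSubmodule Ω s).add_mem hw hw', ?_⟩
    filter_upwards [Lp.coeFn_add z z', hz, hz', condQuot_add (s := s) (γ := γ) w w']
      with p h1 h2 h3 h4
    rw [h1, Pi.add_apply, h2, h3, h4]
  zero_mem' := by
    refine ⟨0, (hsTildeSubmodule Ω s).zero_mem, ?_⟩
    filter_upwards [Lp.coeFn_zero ℝ 2 (volume : Measure (Rn n × Rn n)),
      condQuot_congr (s := s) (γ := γ) (Lp.coeFn_zero ℝ 2 (volume : Measure (Rn n)))] with p h1 h2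
    rw [h1, h2]; simp [condQuot, fracQuot]
  smul_mem' := by
    rintro c z ⟨w, hw, hz⟩
    refine ⟨c • w, (hsTildeSubmodule Ω s).smul_mem c hw, ?_⟩
    filter_upwards [Lp.coeFn_smul c z, hz, condQuot_smul (s := s) (γ := γ) c w] with p h1 h2 h3
    rw [h1, Pi.smul_apply, h2, h3, smul_eq_mul]

theorem exists_subseq_ae_tendsto {α : Type*} [MeasurableSpace α] {μ : Measure α}
    {f : ℕ → Lp ℝ 2 μ} {g : Lp ℝ 2 μ} (h : Tendsto f atTop (𝓝 g)) :
    ∃ ns : ℕ → ℕ, StrictMono ns ∧ ∀ᵐ x ∂μ, Tendsto (fun i => f (ns i) x) atTop (𝓝 (g x)) :=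
  (tendstoInMeasure_of_tendsto_Lp h).exists_seq_tendsto_ae

/-- By coercivity, convergence of the weighted quotients forces the underlying functions to be
Cauchy in `L²`. Almost everywhere convergence identifies the limit of the quotients, and the energy
bound upgrades the convergence to `H^s`. Closedness is what makes orthogonal projection available.
-/
theorem isClosed_condQuotRange (hn : 1 ≤ n) (hs0 : 0 < s) (hs1 : s < 1) (hγ : IsConductivity γ)
    {Ω : Opens (Rn n)} (hΩ : BoundedInOneDirection (Ω : Set (Rn n))) :
    IsClosed (condQuotRange γ Ω s : Set (Lp ℝ 2 (volume : Measure (Rn n × Rn n)))) := by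
  obtain ⟨C₁, hC₁, hP⟩ := exists_eLpNorm_le_gagliardo hs0 hΩ
  obtain ⟨C₂, hC₂, hG⟩ := hγ.exists_gagliardo_le hs0 hs1
  obtain ⟨C₃, hC₃, hH⟩ := exists_hsNorm_le (n := n) hs0
  refine isClosed_of_closure_subset fun z hz => ?_
  obtain ⟨f, hf, hfz⟩ := mem_closure_iff_seq_limit.mp hz
  choose w hw hfw using hf
  have henergy : ∀ i j, ∫⁻ p, ‖condQuot s γ (w i - w j : L2 n) p‖ₑ ^ 2 = ‖f i - f j‖ₑ ^ 2 := by
    intro i j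
    rw [Lp.enorm_def, eLpNorm_two_sq]
    refine lintegral_congr_ae ?_
    filter_upwards [condQuot_sub (s := s) (γ := γ) (w i) (w j), Lp.coeFn_sub (f i) (f j), hfw i,
      hfw j] with p h1 h2 h3 h4
    rw [h1, h2, Pi.sub_apply, h3, h4]
  -- the functions `w i` form a Cauchy sequence in `L²`
  have hcauchy : CauchySeq w := by
    rw [EMetric.cauchySeq_iff]
    intro ε hε
    have h0 : Tendsto (fun x : ℝ≥0∞ => C₁ * C₂ * x ^ 2) (𝓝 0) (𝓝 0) := by
      simpa using ENNReal.Tendsto.const_mul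
        ((ENNReal.continuous_pow 2).tendsto (0 : ℝ≥0∞)) (Or.inr (ENNReal.mul_ne_top hC₁ hC₂))
    obtain ⟨η, hη, hηε⟩ := ENNReal.nhds_zero_basis.eventually_iff.mp
      (h0.eventually (gt_mem_nhds (ENNReal.pow_pos hε 2)))
    obtain ⟨N, hN⟩ := EMetric.cauchySeq_iff.mp hfz.cauchySeq η hη
    refine ⟨N, fun i hi j hj => ?_⟩
    have h1 := hηε (Set.mem_Iio.mpr (hN i hi j hj))
    rw [edist_eq_enorm_sub, mul_assoc, ← henergy] at h1
    rw [edist_eq_enorm_sub]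
    refine (ENNReal.pow_lt_pow_left_iff (n := 2) (by norm_num)).mp (lt_of_le_of_lt ?_ h1)
    rw [Lp.enorm_def]
    refine (hP _ ((hsTildeSubmodule Ω s).sub_mem (hw i) (hw j))).trans ?_
    gcongr
    exact hG _
  obtain ⟨v, hv⟩ := cauchySeq_tendsto_of_complete hcauchy
  -- Two successive subsequences are taken, so that the functions converge at almost every point and
  -- their quotients at almost every pair.
  have hzv : z =ᵐ[volume] condQuot s γ v := by
    obtain ⟨ns, hns, h1⟩ := exists_subseq_ae_tendsto hv
    obtain ⟨ms, hms, h2⟩ := exists_subseq_ae_tendsto (hfz.comp hns.tendsto_atTop)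
    filter_upwards [ae_prod_of_ae h1 h1, h2, ae_all_iff.mpr hfw] with p h3 h4 h5
    refine tendsto_nhds_unique h4 ?_
    simp only [Function.comp_apply, h5]
    simp only [condQuot, fracQuot]
    exact ((((h3.1.comp hms.tendsto_atTop).sub (h3.2.comp hms.tendsto_atTop)).div_const
      _).const_mul _).const_mul _
  have hvH : MemHs s v := memHs_of_memLp_condQuot hn hs0 hs1 hγ
    ((memLp_congr_ae hzv).mp (Lp.memLp z))
  refine ⟨v, memHsTilde_of_approx hvH fun ε hε => ?_, hzv⟩
  have hlim : Tendsto (fun i => C₃ * (‖v - w i‖ₑ ^ 2 + C₂ * ‖z - f i‖ₑ ^ 2)) atTop (𝓝 0) := by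
    have h1 : Tendsto (fun i => ‖v - w i‖ₑ) atTop (𝓝 0) := by
      simpa [edist_eq_enorm_sub, enorm_sub_rev] using tendsto_iff_edist_tendsto_0.mp hv
    have h2 : Tendsto (fun i => ‖z - f i‖ₑ) atTop (𝓝 0) := by
      simpa [edist_eq_enorm_sub, enorm_sub_rev] using tendsto_iff_edist_tendsto_0.mp hfz
    have hsq := (ENNReal.continuous_pow 2).tendsto (0 : ℝ≥0∞)
    have h3 := ENNReal.Tendsto.const_mul (a := C₃) ((hsq.comp h1).add
      (ENNReal.Tendsto.const_mul (a := C₂) (hsq.comp h2) (Or.inr hC₂))) (Or.inr hC₃)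
    simpa using h3
  have hbd : ∀ i, hsNorm s (v - w i) ^ 2 ≤ C₃ * (‖v - w i‖ₑ ^ 2 + C₂ * ‖z - f i‖ₑ ^ 2) := by
    intro i
    refine (hH _).trans ?_
    rw [← Lp.enorm_def]
    gcongr
    refine (hG _).trans (le_of_eq ?_)
    congr 1
    rw [Lp.enorm_def, eLpNorm_two_sq]
    refine lintegral_congr_ae ?_
    filter_upwards [condQuot_sub (s := s) (γ := γ) v (w i), Lp.coeFn_sub z (f i), hfw i,
      hzv] with p h1 h2 h3 h4
    rw [h1, h2, Pi.sub_apply, h3, h4]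
  have hε2 : 0 < ε ^ 2 := ENNReal.pow_pos hε 2
  obtain ⟨i, hi⟩ := (hlim.eventually (gt_mem_nhds hε2)).exists
  refine ⟨w i, hw i, ?_⟩
  exact (ENNReal.pow_lt_pow_left_iff (by norm_num)).mp ((hbd i).trans_lt hi)

/-- Existence of weak solutions of the fractional conductivity equation. -/
theorem exists_isWeakSolution (hn : 1 ≤ n) (hs0 : 0 < s) (hs1 : s < 1) (hγ : IsConductivity γ)
    {Ω : Opens (Rn n)} (hΩ : BoundedInOneDirection (Ω : Set (Rn n))) {f : L2 n}
    (hf : MemHs s f) : ∃ u, IsWeakSolution Ω s γ f u := by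
  set K := condQuotRange γ Ω s with hK
  have hKc : IsClosed (K : Set (Lp ℝ 2 (volume : Measure (Rn n × Rn n)))) :=
    isClosed_condQuotRange hn hs0 hs1 hγ hΩ
  have : CompleteSpace K := hKc.completeSpace_coe
  have hF := memLp_condQuot hn hs0 hs1 hγ hf
  set F : Lp ℝ 2 (volume : Measure (Rn n × Rn n)) := hF.toLp with hFdef
  -- Project the quotient of `f` onto the closed subspace. The quotient of `f - w` is then
  -- orthogonal to those of all test functions, which is the weak equation.
  obtain ⟨w, hw, hwz⟩ := (K.starProjection_apply_mem F : _)
  refine ⟨f - w, (hsSubmodule n s).sub_mem hf hw.1, ?_, fun φ hφ => ?_⟩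
  · rw [sub_sub_cancel_left]
    exact (hsTildeSubmodule Ω s).neg_mem hw
  · have hΦ := memLp_condQuot hn hs0 hs1 hγ hφ.1
    have hmem : hΦ.toLp ∈ K := ⟨φ, hφ, hΦ.coeFn_toLp⟩
    have h0 := K.starProjection_inner_eq_zero F _ hmem
    rw [L2.inner_def] at h0
    rw [condForm_eq, ← h0]
    refine integral_congr_ae ?_
    filter_upwards [Lp.coeFn_sub F (K.starProjection F), hwz, hF.coeFn_toLp, hΦ.coeFn_toLp,
      condQuot_sub (s := s) (γ := γ) f w] with p h1 h2 h3 h4 h5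
    rw [h1, Pi.sub_apply, h2, h3, h4, h5]
    simp [mul_comm]

/-! ### Off-diagonal estimates -/

/-- The kernel `|z|^{-n-2s}`, cut off near the origin. -/
noncomputable def tailKernel (s δ : ℝ) : Rn n → ℝ≥0∞ :=
  {z : Rn n | δ ≤ ‖z‖}.indicator (fracKernel s)

theorem measurableSet_le_norm (δ : ℝ) : MeasurableSet {z : Rn n | δ ≤ ‖z‖} :=
  measurableSet_le measurable_const measurable_norm

@[fun_prop]
theorem measurable_tailKernel {δ : ℝ} : Measurable (tailKernel (n := n) s δ) :=
  measurable_fracKernel.indicator (measurableSet_le_norm δ)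

theorem lintegral_tailKernel_lt_top (hs0 : 0 < s) {δ : ℝ} (hδ : 0 < δ) :
    ∫⁻ z : Rn n, tailKernel s δ z < ⊤ := by
  rw [tailKernel, lintegral_indicator (measurableSet_le_norm δ)]
  exact lintegral_fracKernel_tail hs0 hδ

theorem tailKernel_of_le {δ : ℝ} {z : Rn n} (h : δ ≤ ‖z‖) : tailKernel s δ z = fracKernel s z :=
  Set.indicator_of_mem (s := {z : Rn n | δ ≤ ‖z‖}) h _

/-- Tonelli and translation invariance: for each summand the kernel is integrated first, in the
variable on which `g` does not depend. -/
theorem lintegral_tailKernel_mul_add {δ : ℝ} {g : Rn n → ℝ≥0∞} (hg : Measurable g) :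
    ∫⁻ p : Rn n × Rn n, tailKernel s δ (p.1 - p.2) * (g p.1 + g p.2) =
      2 * (∫⁻ z : Rn n, tailKernel s δ z) * ∫⁻ x, g x := by
  have h1 : ∫⁻ p : Rn n × Rn n, tailKernel s δ (p.1 - p.2) * g p.1 =
      (∫⁻ z : Rn n, tailKernel s δ z) * ∫⁻ x, g x := by
    rw [Measure.volume_eq_prod, lintegral_prod _ (by fun_prop), ← lintegral_const_mul _ hg]
    refine lintegral_congr fun x => ?_
    dsimp only
    rw [lintegral_mul_const _ (by fun_prop), lintegral_sub_left_eq_self]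
  have h2 : ∫⁻ p : Rn n × Rn n, tailKernel s δ (p.1 - p.2) * g p.2 =
      (∫⁻ z : Rn n, tailKernel s δ z) * ∫⁻ x, g x := by
    rw [Measure.volume_eq_prod, lintegral_prod_symm _ (by fun_prop), ← lintegral_const_mul _ hg]
    refine lintegral_congr fun y => ?_
    dsimp only
    rw [lintegral_mul_const _ (by fun_prop), lintegral_sub_right_eq_self]
  simp_rw [mul_add]
  rw [lintegral_add_left (by fun_prop), h1, h2]
  ring

theorem fracQuot_mul_fracQuot (hs0 : 0 < s) (hs1 : s < 1) (u v : Rn n → ℝ) (p : Rn n × Rn n) :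
    fracQuot s u p * fracQuot s v p = fracConst n s / 2 *
      (‖p.1 - p.2‖ ^ (-((n : ℝ) + 2 * s)) * ((u p.1 - u p.2) * (v p.1 - v p.2))) := by
  have hc := fracConst_pos (n := n) hs0 hs1
  have h1 : ‖p.1 - p.2‖ ^ ((n : ℝ) + 2 * s) =
      ‖p.1 - p.2‖ ^ ((n : ℝ) / 2 + s) * ‖p.1 - p.2‖ ^ ((n : ℝ) / 2 + s) := by
    rw [← Real.rpow_add_of_nonneg (norm_nonneg _) (by positivity) (by positivity)]
    congr 1; ring
  rw [fracQuot, fracQuot, mul_mul_mul_comm, Real.mul_self_sqrt (by positivity), div_mul_div_comm,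
    ← h1, Real.rpow_neg (norm_nonneg _)]
  rw [div_eq_inv_mul ((u p.1 - u p.2) * _)]

theorem condQuot_mul_condQuot (u v : Rn n → ℝ) (p : Rn n × Rn n) :
    condQuot s γ u p * condQuot s γ v p =
      √(γ p.1) * √(γ p.2) * (fracQuot s u p * fracQuot s v p) := by
  rw [← condWeight_mul_self, condQuot, condQuot]; ring

/-- The conductivity form of two functions with separated supports is bounded in `L²`. -/
theorem enorm_condForm_le_of_separated (hs0 : 0 < s) (hs1 : s < 1) {M : ℝ}
    (hM : ∀ᵐ p : Rn n × Rn n, √(γ p.1) * √(γ p.2) ≤ M) {u v : L2 n} {S₁ S₂ : Set (Rn n)} {δ : ℝ}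
    (hδ : 0 < δ) (hu : ∀ᵐ x, x ∉ S₁ → u x = 0) (hv : ∀ᵐ x, x ∉ S₂ → v x = 0)
    (hsep : ∀ x ∈ S₁, ∀ y ∈ S₂, δ ≤ ‖x - y‖) {t : ℝ} (ht : 0 < t) :
    ‖condForm s γ u v‖ₑ ≤ ENNReal.ofReal (M * (fracConst n s / 2)) *
      (2 * (∫⁻ z : Rn n, tailKernel s δ z)) * (ENNReal.ofReal t * eLpNorm u 2 volume ^ 2 +
        ENNReal.ofReal t⁻¹ * eLpNorm v 2 volume ^ 2) := by
  have hc := fracConst_pos (n := n) hs0 hs1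
  have hum := measurable_coe_L2 u
  have hvm := measurable_coe_L2 v
  set g : Rn n → ℝ≥0∞ := fun x => ENNReal.ofReal t * ‖u x‖ₑ ^ 2 + ENNReal.ofReal t⁻¹ * ‖v x‖ₑ ^ 2
    with hg
  have hgm : Measurable g := by fun_prop
  have hgint : ∫⁻ x, g x = ENNReal.ofReal t * eLpNorm u 2 volume ^ 2 +
      ENNReal.ofReal t⁻¹ * eLpNorm v 2 volume ^ 2 := by
    rw [hg, lintegral_add_left (by fun_prop), lintegral_const_mul _ (by fun_prop),
      lintegral_const_mul _ (by fun_prop), eLpNorm_two_sq, eLpNorm_two_sq]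
  have hgreal : ∀ x, g x = ENNReal.ofReal (t * u x ^ 2 + t⁻¹ * v x ^ 2) := by
    intro x
    rw [ENNReal.ofReal_add (by positivity) (by positivity), ENNReal.ofReal_mul ht.le,
      ENNReal.ofReal_mul (inv_pos.mpr ht).le]
    simp only [hg, Real.enorm_eq_ofReal_abs]
    rw [← ENNReal.ofReal_pow (abs_nonneg _), ← ENNReal.ofReal_pow (abs_nonneg _), sq_abs, sq_abs]
  rw [condForm_eq]
  refine (enorm_integral_le_lintegral_enorm _).trans ?_
  rw [← hgint, mul_assoc, ← lintegral_tailKernel_mul_add hgm,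
    ← lintegral_const_mul' _ _ ENNReal.ofReal_ne_top]
  refine lintegral_mono_ae ?_
  have hdisj : ∀ x, (x ∉ S₁ → u x = 0) → (x ∉ S₂ → v x = 0) → u x * v x = 0 := by
    intro x h1 h2
    by_cases hx1 : x ∈ S₁
    · by_cases hx2 : x ∈ S₂
      · have := hsep x hx1 x hx2
        simp at this; linarith
      · rw [h2 hx2, mul_zero]
    · rw [h1 hx1, zero_mul]
  have hcross : ∀ x y, ‖x - y‖ < δ → (x ∉ S₁ → u x = 0) → (y ∉ S₂ → v y = 0) →
      u x * v y = 0 := by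
    intro x y hxy h1 h2
    by_cases hx1 : x ∈ S₁
    · by_cases hy2 : y ∈ S₂
      · exact absurd (hsep x hx1 y hy2) (not_le.mpr hxy)
      · rw [h2 hy2, mul_zero]
    · rw [h1 hx1, zero_mul]
  filter_upwards [hM, ae_prod_of_ae hu hu, ae_prod_of_ae hv hv] with p hp ⟨hu1, hu2⟩ ⟨hv1, hv2⟩
  -- The supports are disjoint since `δ > 0`, so the diagonal terms `u v` vanish and only cross
  -- terms remain. These vanish for `|x - y| < δ`, so the kernel may be cut off there.
  have hprod : (u p.1 - u p.2) * (v p.1 - v p.2) = -(u p.1 * v p.2 + u p.2 * v p.1) := by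
    linear_combination hdisj _ hu1 hv1 + hdisj _ hu2 hv2
  rw [condQuot_mul_condQuot, fracQuot_mul_fracQuot hs0 hs1, hprod]
  rcases lt_or_ge ‖p.1 - p.2‖ δ with hlt | hge
  · rw [hcross _ _ hlt hu1 hv2, hcross _ _ (by rwa [norm_sub_rev]) hu2 hv1]
    simp
  · have hM0 : 0 ≤ M := le_trans (by positivity) hp
    rw [tailKernel_of_le hge, fracKernel, hgreal, hgreal, ← ENNReal.ofReal_add (by positivity)
      (by positivity), ← ENNReal.ofReal_mul (by positivity), ← ENNReal.ofReal_mul (by positivity),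
      Real.enorm_eq_ofReal_abs]
    refine ENNReal.ofReal_le_ofReal ?_
    rw [abs_mul (√(γ p.1) * √(γ p.2)), abs_mul (fracConst n s / 2), abs_mul (_ ^ _), abs_neg,
      abs_of_nonneg (by positivity : 0 ≤ √(γ p.1) * √(γ p.2)),
      abs_of_nonneg (by positivity : 0 ≤ fracConst n s / 2),
      abs_of_nonneg (by positivity : 0 ≤ ‖p.1 - p.2‖ ^ (-((n : ℝ) + 2 * s))), mul_assoc M]
    have hyoung : ∀ a b : ℝ, |a * b| ≤ t * a ^ 2 + t⁻¹ * b ^ 2 := by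
      intro a b
      have h1 : t * a ^ 2 + t⁻¹ * b ^ 2 = t⁻¹ * ((t * a) ^ 2 + b ^ 2) := by field_simp
      have h2 : |a * b| = t⁻¹ * |t * a * b| := by
        rw [mul_assoc, abs_mul t, abs_of_pos ht]; field_simp
      rw [h1, h2]
      refine mul_le_mul_of_nonneg_left (abs_le.mpr ⟨?_, ?_⟩) (by positivity)
      · nlinarith [sq_nonneg (t * a + b), sq_nonneg (t * a), sq_nonneg b]
      · nlinarith [sq_nonneg (t * a - b), sq_nonneg (t * a), sq_nonneg b]
    gcongr
    refine (abs_add_le _ _).trans ?_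
    linarith [hyoung (u p.1) (v p.2), hyoung (u p.2) (v p.1)]

/-- For an exterior value that is supported away from `Ω`, replacing the weak solution by the
exterior value changes the Dirichlet-to-Neumann pairing by at most a multiple of the squared
`L²` norm. -/
theorem exists_enorm_dnMap_sub_le (hn : 1 ≤ n) (hs0 : 0 < s) (hs1 : s < 1)
    (hγ : IsConductivity γ) {Ω : Opens (Rn n)} (hΩ : BoundedInOneDirection (Ω : Set (Rn n)))
    {S : Set (Rn n)} {δ : ℝ} (hδ : 0 < δ) (hsep : ∀ x ∈ (Ω : Set (Rn n)), ∀ y ∈ S, δ ≤ ‖x - y‖) :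
    ∃ C : ℝ≥0∞, C ≠ ⊤ ∧ ∀ f : L2 n, MemHs s f → (∀ᵐ x, x ∉ S → f x = 0) →
      ‖dnMap Ω s γ f f - condForm s γ f f‖ₑ ≤ C * eLpNorm f 2 volume ^ 2 := by
  obtain ⟨a, M, ha, -, hb⟩ := hγ.exists_bounds
  have hM : ∀ᵐ p : Rn n × Rn n, √(γ p.1) * √(γ p.2) ≤ M := by
    filter_upwards [ae_prod_of_ae hb hb] with p hp
    exact (sqrt_mul_sqrt_bounds ha hp.1 hp.2).2
  obtain ⟨C₁, hC₁, hP⟩ := exists_eLpNorm_le_gagliardo hs0 hΩ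
  obtain ⟨C₂, hC₂, hG⟩ := hγ.exists_gagliardo_le hs0 hs1
  set D : ℝ≥0∞ := ENNReal.ofReal (M * (fracConst n s / 2)) *
      (2 * (∫⁻ z : Rn n, tailKernel s δ z)) with hD
  have hDt : D ≠ ⊤ := ENNReal.mul_ne_top ENNReal.ofReal_ne_top
    (ENNReal.mul_ne_top (by simp) (lintegral_tailKernel_lt_top hs0 hδ).ne)
  set A : ℝ≥0∞ := D * (C₁ * C₂) with hA
  have hAt : A ≠ ⊤ := ENNReal.mul_ne_top hDt (ENNReal.mul_ne_top hC₁ hC₂)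
  -- Young's parameter is chosen so that `A t ≤ 1/2`: the contribution of `w` is then at most half
  -- of its own energy `E`.
  set t : ℝ := 1 / (2 * (A.toReal + 1)) with ht
  have hA0 : 0 ≤ A.toReal := ENNReal.toReal_nonneg
  have ht0 : 0 < t := by positivity
  have htA : A * ENNReal.ofReal t ≤ 2⁻¹ := by
    rw [← ENNReal.ofReal_toReal hAt, ← ENNReal.ofReal_mul hA0, ← ENNReal.ofReal_ofNat 2,
      ← ENNReal.ofReal_inv_of_pos (by norm_num)]
    refine ENNReal.ofReal_le_ofReal ?_
    rw [ht, mul_one_div, div_le_iff₀ (by positivity)]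
    linarith
  refine ⟨2 * (D * ENNReal.ofReal t⁻¹), ENNReal.mul_ne_top (by simp)
    (ENNReal.mul_ne_top hDt ENNReal.ofReal_ne_top), fun f hf hfS => ?_⟩
  have hex := exists_isWeakSolution hn hs0 hs1 hγ hΩ hf
  rw [dnMap, dif_pos hex]
  -- Existence excludes the default value `0` of `dnMap`. Only the defining properties of the chosen
  -- solution are used.
  obtain ⟨hu, hw, hweak⟩ := hex.choose_spec
  set u := hex.choose
  set w := u - f with hwdef
  have huw : u = f + w := by rw [hwdef]; abel
  have h1 : condForm s γ u f - condForm s γ f f = condForm s γ w f := by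
    rw [huw, condForm_add_left hn hs0 hs1 hγ hf hw.1 hf]; ring
  have h2 : condForm s γ w f = -condForm s γ w w := by
    have := hweak w hw
    rw [huw, condForm_add_left hn hs0 hs1 hγ hf hw.1 hw.1, condForm_comm f w] at this
    linarith
  set E : ℝ≥0∞ := ∫⁻ p, ‖condQuot s γ w p‖ₑ ^ 2 with hE
  have hwLp := memLp_condQuot hn hs0 hs1 hγ hw.1
  have hEt : E ≠ ⊤ := by
    rw [hE, ← eLpNorm_two_sq]; exact (ENNReal.pow_lt_top hwLp.2).ne
  have hEform : ‖condForm s γ w f‖ₑ = E := by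
    rw [h2, enorm_neg, condForm_eq, Real.enorm_of_nonneg (integral_nonneg fun p =>
      mul_self_nonneg _), ofReal_integral_eq_lintegral_ofReal
      (integrable_condQuot_mul hn hs0 hs1 hγ hw.1 hw.1) (Eventually.of_forall fun p =>
      mul_self_nonneg _), hE]
    refine lintegral_congr fun p => ?_
    rw [sq, ← enorm_mul, Real.enorm_of_nonneg (mul_self_nonneg _)]
  have h3 := enorm_condForm_le_of_separated hs0 hs1 hM hδ (hw.ae_eq_zero hs0) hfS hsep ht0
  rw [h1, hEform]
  rw [hEform, ← hD, mul_add] at h3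
  have h4 : D * (ENNReal.ofReal t * eLpNorm w 2 volume ^ 2) ≤ E / 2 := by
    calc _ ≤ D * (ENNReal.ofReal t * (C₁ * (C₂ * E))) := by
          gcongr; exact (hP w hw).trans (mul_le_mul_right (hG w) _)
      _ = A * ENNReal.ofReal t * E := by rw [hA]; ring
      _ ≤ 2⁻¹ * E := by gcongr
      _ = E / 2 := by rw [ENNReal.div_eq_inv_mul]
  have h5 : E / 2 ≤ D * (ENNReal.ofReal t⁻¹ * eLpNorm f 2 volume ^ 2) := by
    -- Absorption: `E / 2` can be cancelled because the energy of `w` is finite.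
    refine (ENNReal.add_le_add_iff_left (a := E / 2) (ENNReal.div_lt_top hEt (by simp)).ne).mp ?_
    rw [ENNReal.add_halves]
    exact h3.trans (add_le_add h4 le_rfl)
  calc E = E / 2 + E / 2 := (ENNReal.add_halves E).symm
    _ ≤ _ := add_le_add h5 h5
    _ = _ := by ring

/-! ### Concentration of energy -/

theorem memLp_fracQuot (hn : 1 ≤ n) (hs0 : 0 < s) (hs1 : s < 1) {u : L2 n} (hu : MemHs s u) :
    MemLp (fracQuot s u) 2 volume := by
  refine ⟨(measurable_fracQuot (measurable_coe_L2 u)).aestronglyMeasurable, ?_⟩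
  have h : eLpNorm (fracQuot s u) 2 volume ^ 2 < ⊤ := by
    rw [eLpNorm_two_sq, lintegral_fracQuot_sq hs0 hs1 (measurable_coe_L2 u)]
    exact ENNReal.mul_lt_top (by simp) ((memHs_iff_gagliardo_lt_top hn hs0 hs1 u).mp hu)
  by_contra h3
  rw [not_lt, top_le_iff] at h3
  simp [h3] at h

/-- The conductivity form of a function that is concentrated where the weight is almost equal to
`c` is almost `c` times its energy. -/
theorem lintegral_weight_sub_mul_sq_le (hs0 : 0 < s) (hs1 : s < 1) {M c ε r : ℝ} (hr : 0 < r)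
    (hM0 : 0 ≤ M) (hM : ∀ᵐ p : Rn n × Rn n, √(γ p.1) * √(γ p.2) ≤ M) {x₀ : Rn n}
    (hε : ∀ x ∈ Metric.ball x₀ (2 * r), ∀ y ∈ Metric.ball x₀ (2 * r), |√(γ x) * √(γ y) - c| ≤ ε)
    {u : L2 n} (hu : ∀ᵐ x, x ∉ Metric.ball x₀ r → u x = 0) :
    ∫⁻ p : Rn n × Rn n, ‖(√(γ p.1) * √(γ p.2) - c) * fracQuot s u p ^ 2‖ₑ ≤
      ENNReal.ofReal ε * eLpNorm (fracGrad s u) 2 volume ^ 2 +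
      ENNReal.ofReal ((M + |c|) * (fracConst n s / 2)) *
        (2 * (∫⁻ z : Rn n, tailKernel s r z)) * eLpNorm u 2 volume ^ 2 := by
  have hcpos := fracConst_pos (n := n) hs0 hs1
  have hum := measurable_coe_L2 u
  have hq := measurable_fracQuot (s := s) hum
  rw [eLpNorm_fracGrad_sq hs0 hs1, ← lintegral_fracQuot_sq hs0 hs1 hum, eLpNorm_two_sq, mul_assoc,
    ← lintegral_tailKernel_mul_add (by fun_prop), ← lintegral_const_mul _ (by fun_prop),
    ← lintegral_const_mul _ (by fun_prop), ← lintegral_add_left (by fun_prop)]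
  refine lintegral_mono_ae ?_
  -- the contribution of pairs of points of which the first one is far away from `x₀`
  have far : ∀ x y : Rn n, x ∉ Metric.ball x₀ (2 * r) → (x ∉ Metric.ball x₀ r → u x = 0) →
      (y ∉ Metric.ball x₀ r → u y = 0) → fracKernel s (x - y) * ‖u x - u y‖ₑ ^ 2 ≤
      tailKernel s r (x - y) * (‖u x‖ₑ ^ 2 + ‖u y‖ₑ ^ 2) := by
    intro x y hx hux huy
    have hx0 : u x = 0 := hux fun h => hx (Metric.ball_subset_ball (by linarith) h)
    rw [hx0, zero_sub, enorm_neg]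
    by_cases hy : y ∈ Metric.ball x₀ r
    · have hle : r ≤ ‖x - y‖ := by
        rw [Metric.mem_ball, not_lt] at hx
        rw [Metric.mem_ball] at hy
        rw [← dist_eq_norm]
        linarith [dist_triangle x y x₀]
      rw [tailKernel_of_le hle]
      gcongr
      exact le_add_self
    · simp [huy hy]
  filter_upwards [hM, ae_prod_of_ae hu hu] with p hp ⟨hu1, hu2⟩
  rw [enorm_mul, enorm_pow]
  -- Near pairs are controlled by the oscillation `ε` of the weight. Otherwise one point is outside
  -- the ball of radius `2r`, hence at distance at least `r` from the ball carrying `u`, and the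
  -- truncated kernel suffices.
  by_cases hnear : p.1 ∈ Metric.ball x₀ (2 * r) ∧ p.2 ∈ Metric.ball x₀ (2 * r)
  · refine le_trans ?_ le_self_add
    gcongr
    rw [Real.enorm_eq_ofReal_abs]
    exact ENNReal.ofReal_le_ofReal (hε _ hnear.1 _ hnear.2)
  · refine le_trans ?_ le_add_self
    rw [enorm_fracQuot_sq hs0 hs1, ENNReal.ofReal_mul (by positivity), mul_assoc]
    refine mul_le_mul' ?_ (mul_le_mul_right ?_ _)
    · rw [Real.enorm_eq_ofReal_abs]
      refine ENNReal.ofReal_le_ofReal ((abs_sub _ _).trans ?_)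
      rw [abs_of_nonneg (by positivity : 0 ≤ √(γ p.1) * √(γ p.2))]
      linarith
    · by_cases h1 : p.1 ∈ Metric.ball x₀ (2 * r)
      · have h2 : p.2 ∉ Metric.ball x₀ (2 * r) := fun h => hnear ⟨h1, h⟩
        have h3 := far p.2 p.1 h2 hu2 hu1
        have h4 : tailKernel s r (p.2 - p.1) = tailKernel s r (p.1 - p.2) := by
          simp only [tailKernel, Set.indicator, Set.mem_ofPred_eq, norm_sub_rev p.2 p.1, fracKernel]
        rw [h4, ← neg_sub p.1 p.2, fracKernel_neg, ← neg_sub (u p.1), enorm_neg, add_comm] at h3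
        exact h3
      · exact far _ _ h1 hu1 hu2

/-- The normalization writes `c` as `c` times the energy plus `c ‖u‖²_{L²}`. The first part combines
with the form into an integral of the weight defect; the second is itself an `L²` error. -/
theorem enorm_condForm_sub_le (hn : 1 ≤ n) (hs0 : 0 < s) (hs1 : s < 1) (hγ : IsConductivity γ)
    {M c ε r : ℝ} (hr : 0 < r)
    (hM0 : 0 ≤ M) (hM : ∀ᵐ p : Rn n × Rn n, √(γ p.1) * √(γ p.2) ≤ M) {x₀ : Rn n}
    (hε : ∀ x ∈ Metric.ball x₀ (2 * r), ∀ y ∈ Metric.ball x₀ (2 * r), |√(γ x) * √(γ y) - c| ≤ ε)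
    {u : L2 n} (hu : ∀ᵐ x, x ∉ Metric.ball x₀ r → u x = 0) (huH : MemHs s u)
    (hnorm : eLpNorm u 2 volume ^ 2 + eLpNorm (fracGrad s u) 2 volume ^ 2 = 1) :
    ‖condForm s γ u u - c‖ₑ ≤ ENNReal.ofReal ε +
      (ENNReal.ofReal ((M + |c|) * (fracConst n s / 2)) *
        (2 * (∫⁻ z : Rn n, tailKernel s r z)) + ‖c‖ₑ) * eLpNorm u 2 volume ^ 2 := by
  have hmain := lintegral_weight_sub_mul_sq_le hs0 hs1 hr hM0 hM hε hu
  set X := eLpNorm u 2 volume ^ 2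
  set Y := eLpNorm (fracGrad s u) 2 volume ^ 2 with hY
  have hX1 : X ≤ 1 := hnorm ▸ le_self_add
  have hY1 : Y ≤ 1 := hnorm ▸ le_add_self
  have hXt : X ≠ ⊤ := ne_top_of_le_ne_top ENNReal.one_ne_top hX1
  have hYt : Y ≠ ⊤ := ne_top_of_le_ne_top ENNReal.one_ne_top hY1
  have hsum : X.toReal + Y.toReal = 1 := by
    rw [← ENNReal.toReal_add hXt hYt, hnorm, ENNReal.toReal_one]
  have hq := memLp_fracQuot hn hs0 hs1 huH
  have hqint : Integrable fun p => fracQuot s u p ^ 2 := hq.integrable_sq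
  have hYint : ∫ p, fracQuot s u p ^ 2 = Y.toReal := by
    rw [integral_eq_lintegral_of_nonneg_ae (Eventually.of_forall fun p => sq_nonneg _)
      hqint.aestronglyMeasurable, hY, eLpNorm_fracGrad_sq hs0 hs1,
      ← lintegral_fracQuot_sq hs0 hs1 (measurable_coe_L2 u)]
    congr 1
    refine lintegral_congr fun p => ?_
    rw [← Real.enorm_of_nonneg (sq_nonneg _), enorm_pow]
  have hform : condForm s γ u u - c =
      (∫ p : Rn n × Rn n, (√(γ p.1) * √(γ p.2) - c) * fracQuot s u p ^ 2) - c * X.toReal := by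
    have h1 : ∫ p : Rn n × Rn n, (√(γ p.1) * √(γ p.2) - c) * fracQuot s u p ^ 2 =
        condForm s γ u u - c * Y.toReal := by
      rw [← hYint, condForm_eq, ← integral_const_mul,
        ← integral_sub (integrable_condQuot_mul hn hs0 hs1 hγ huH huH) (hqint.const_mul c)]
      refine integral_congr_ae (Eventually.of_forall fun p => ?_)
      dsimp only
      rw [condQuot_mul_condQuot]; ring
    rw [h1]
    linear_combination c * hsum
  rw [hform]
  refine (enorm_sub_le).trans ?_
  rw [enorm_mul, add_mul, ← add_assoc]
  refine add_le_add (((enorm_integral_le_lintegral_enorm _).trans hmain).trans ?_) ?_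
  · gcongr
    exact mul_le_of_le_one_right' hY1
  · rw [Real.enorm_of_nonneg ENNReal.toReal_nonneg, ENNReal.ofReal_toReal hXt]

/-! ### Reconstruction of the conductivity -/

theorem IsConductivity.exists_sqrt_mul_sqrt_sub_le (hγ : IsConductivity γ) {x₀ : Rn n}
    (hc : ContinuousAt γ x₀) {ε : ℝ} (hε : 0 < ε) :
    ∃ ρ > 0, ∀ x ∈ Metric.ball x₀ ρ, ∀ y ∈ Metric.ball x₀ ρ, |√(γ x) * √(γ y) - γ x₀| ≤ ε := by
  -- The lower bound holds only almost everywhere, but a set of full measure is dense, so continuity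
  -- transfers the sign to `x₀`. It is needed for `√(γ x₀) * √(γ x₀) = γ x₀`.
  have hpos : 0 ≤ γ x₀ := by
    obtain ⟨a, ha, hae⟩ := hγ.2
    by_contra! hneg
    have h1 : ∀ᶠ x in 𝓝 x₀, γ x < 0 := hc.eventually (gt_mem_nhds hneg)
    have h2 : ∃ᶠ x in 𝓝 x₀, a ≤ γ x :=
      mem_closure_iff_frequently.mp (Measure.dense_of_ae hae x₀)
    obtain ⟨x, hx1, hx2⟩ := (h2.and_eventually h1).exists
    linarith
  have h : ContinuousAt (fun p : Rn n × Rn n => √(γ p.1) * √(γ p.2)) (x₀, x₀) :=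
    (hc.comp_of_eq continuousAt_fst rfl).sqrt.mul (hc.comp_of_eq continuousAt_snd rfl).sqrt
  obtain ⟨ρ, hρ, hball⟩ := Metric.continuousAt_iff.mp h ε hε
  refine ⟨ρ, hρ, fun x hx y hy => ?_⟩
  have := hball (x := (x, y)) (by rw [Prod.dist_eq]; exact max_lt hx hy)
  rw [Real.mul_self_sqrt hpos, Real.dist_eq] at this
  exact this.le

theorem eLpNorm_testL2 {U : Opens (Rn n)} (φ : 𝓓(U, ℝ)) :
    eLpNorm (testL2 φ) 2 volume = eLpNorm φ 2 volume :=
  eLpNorm_congr_ae (coeFn_testL2 φ)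

theorem testL2_ae_eq_zero {U : Opens (Rn n)} (φ : 𝓓(U, ℝ)) {S : Set (Rn n)}
    (h : tsupport φ ⊆ S) : ∀ᵐ x, x ∉ S → testL2 φ x = 0 := by
  filter_upwards [coeFn_testL2 φ] with x hx hxS
  rw [hx]
  exact image_eq_zero_of_notMem_tsupport fun hm => hxS (h hm)

/-- The conductivity at a point is recovered from the energies of exterior values that concentrate
there. -/
theorem tendsto_dnMap_of_concentratesAt (hn : 1 ≤ n) (hs0 : 0 < s) (hs1 : s < 1)
    {Ω W : Opens (Rn n)} (hΩ : BoundedInOneDirection (Ω : Set (Rn n))) {x₀ : Rn n}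
    (hx₀ : x₀ ∉ closure (Ω : Set (Rn n))) {φ : ℕ → 𝓓(W, ℝ)} (hφ : ConcentratesAt s φ x₀)
    (hγ : IsConductivity γ) (hc : ContinuousAt γ x₀) :
    Tendsto (fun N => dnMap Ω s γ (testL2 (φ N)) (testL2 (φ N))) atTop (𝓝 (γ x₀)) := by
  obtain ⟨δ, hδ, hsep⟩ : ∃ δ > 0, ∀ x ∈ (Ω : Set (Rn n)), ∀ y ∈ Metric.ball x₀ δ,
      δ ≤ ‖x - y‖ := by
    obtain ⟨d, hd, hball⟩ := Metric.isOpen_iff.mp isClosed_closure.isOpen_compl x₀ hx₀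
    refine ⟨d / 2, by positivity, fun x hx y hy => ?_⟩
    have h1 : d ≤ dist x x₀ := by
      by_contra! hlt
      exact hball hlt (subset_closure hx)
    rw [Metric.mem_ball] at hy
    rw [← dist_eq_norm]
    linarith [dist_triangle x y x₀]
  obtain ⟨C, hC, hdn⟩ := exists_enorm_dnMap_sub_le hn hs0 hs1 hγ hΩ hδ hsep
  obtain ⟨a, M, ha, hM0, hb⟩ := hγ.exists_bounds
  have hM : ∀ᵐ p : Rn n × Rn n, √(γ p.1) * √(γ p.2) ≤ M := by
    filter_upwards [ae_prod_of_ae hb hb] with p hp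
    exact (sqrt_mul_sqrt_bounds ha hp.1 hp.2).2
  rw [tendsto_iff_edist_tendsto_0, ENNReal.tendsto_nhds_zero]
  intro η hη
  obtain ⟨ε, hε, hεη⟩ : ∃ ε : ℝ, 0 < ε ∧ ENNReal.ofReal ε ≤ η / 2 := by
    have hmin : min (η / 2) 1 ≠ ⊤ := ne_top_of_le_ne_top ENNReal.one_ne_top (min_le_right _ _)
    -- Capping at `1` keeps `ε` a positive real when `η = ⊤`.
    refine ⟨(min (η / 2) 1).toReal, ENNReal.toReal_pos
      (lt_min (ENNReal.half_pos hη.ne') one_pos).ne' hmin, ?_⟩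
    rw [ENNReal.ofReal_toReal hmin]
    exact min_le_left _ _
  obtain ⟨ρ, hρ, hcont⟩ := hγ.exists_sqrt_mul_sqrt_sub_le hc hε
  -- The energy estimate needs the weight to be controlled on a ball of twice the support radius,
  -- hence `ρ / 2`.
  have hr : 0 < ρ / 2 := by positivity
  set B : ℝ≥0∞ := ENNReal.ofReal ((M + |γ x₀|) * (fracConst n s / 2)) *
    (2 * (∫⁻ z : Rn n, tailKernel s (ρ / 2) z)) + ‖γ x₀‖ₑ with hB
  have hBt : B ≠ ⊤ := ENNReal.add_ne_top.mpr ⟨ENNReal.mul_ne_top ENNReal.ofReal_ne_top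
    (ENNReal.mul_ne_top (by simp) (lintegral_tailKernel_lt_top hs0 hr).ne), enorm_ne_top⟩
  -- `B` depends on `ε` through `ρ` but not on `N`, so with `ε` fixed the remaining error vanishes
  -- as `N → ∞`.
  have hlim : Tendsto (fun N => (C + B) * eLpNorm (φ N) 2 volume ^ 2) atTop (𝓝 0) := by
    simpa using ENNReal.Tendsto.const_mul (((ENNReal.continuous_pow 2).tendsto 0).comp
      hφ.tendsto_zero) (Or.inr (ENNReal.add_ne_top.mpr ⟨hC, hBt⟩))
  filter_upwards [hφ.support_shrinks δ hδ, hφ.support_shrinks _ hr,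
    (ENNReal.tendsto_nhds_zero.mp hlim) (η / 2) (ENNReal.half_pos hη.ne')] with N h1 h2 h3
  have hH : MemHs s (testL2 (φ N)) := memHs_testL2 _
  have e1 := hdn _ hH (testL2_ae_eq_zero _ h1)
  have e2 := enorm_condForm_sub_le hn hs0 hs1 hγ hr hM0.le hM (c := γ x₀) (ε := ε)
    (by rwa [mul_div_cancel₀ _ (two_ne_zero' ℝ)]) (testL2_ae_eq_zero _ h2) hH
    (by rw [eLpNorm_testL2]; exact hφ.normalized N)
  rw [eLpNorm_testL2] at e1 e2
  rw [edist_eq_enorm_sub, ← sub_add_sub_cancel _ (condForm s γ (testL2 (φ N)) (testL2 (φ N)))]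
  calc _ ≤ C * eLpNorm (φ N) 2 volume ^ 2 + (ENNReal.ofReal ε + B * eLpNorm (φ N) 2 volume ^ 2) :=
        (enorm_add_le _ _).trans (add_le_add e1 e2)
    _ = ENNReal.ofReal ε + (C + B) * eLpNorm (φ N) 2 volume ^ 2 := by ring
    _ ≤ η / 2 + η / 2 := add_le_add hεη h3
    _ = η := ENNReal.add_halves η

/-! ### Concentrating test functions -/

theorem gagliardo_const_smul (c : ℝ) (u : Rn n → ℝ) :
    gagliardo s (c • u) = ‖c‖ₑ ^ 2 * gagliardo s u := by
  have hct : ‖c‖ₑ ^ 2 ≠ ⊤ := by simp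
  rw [gagliardo, gagliardo, ← lintegral_const_mul' _ _ hct]
  refine lintegral_congr fun h => ?_
  rw [mul_left_comm, ← lintegral_const_mul' _ _ hct]
  congr 1
  refine lintegral_congr fun y => ?_
  rw [Pi.smul_apply, Pi.smul_apply, ← smul_sub, enorm_smul, mul_pow]

/-- Rescale a bump function: the squared norm `A` is quadratic, finite, and nonzero because the bump
is continuous and equals `1` at `x₀`. -/
theorem exists_normalized_testFunction (hn : 1 ≤ n) (hs0 : 0 < s) (hs1 : s < 1)
    {W : Opens (Rn n)} {x₀ : Rn n} (hx₀ : x₀ ∈ W) {r : ℝ} (hr : 0 < r) :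
    ∃ φ : 𝓓(W, ℝ), tsupport φ ⊆ Metric.ball x₀ r ∧
      eLpNorm φ 2 volume ^ 2 + eLpNorm (fracGrad s (testL2 φ)) 2 volume ^ 2 = 1 := by
  obtain ⟨ρ, hρ, hball⟩ := Metric.isOpen_iff.mp W.isOpen x₀ hx₀
  set R : ℝ := min ρ r / 2 with hR
  have hR0 : 0 < R := by positivity
  have hRρ : R < ρ := by have := min_le_left ρ r; linarith [lt_min hρ hr]
  have hRr : R < r := by have := min_le_right ρ r; linarith [lt_min hρ hr]
  let b : ContDiffBump x₀ := ⟨R / 2, R, by positivity, by linarith⟩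
  have hbs : tsupport b ⊆ Metric.closedBall x₀ R := b.tsupport_eq.subset
  let ψ : 𝓓(W, ℝ) := ⟨b, b.contDiff, b.hasCompactSupport,
    hbs.trans ((Metric.closedBall_subset_ball hRρ).trans hball)⟩
  set A : ℝ≥0∞ := eLpNorm ψ 2 volume ^ 2 + ENNReal.ofReal (fracConst n s / 2) *
    gagliardo s (testL2 ψ) with hA
  have hAt : A ≠ ⊤ := by
    refine ENNReal.add_ne_top.mpr ⟨?_, ENNReal.mul_ne_top ENNReal.ofReal_ne_top
      ((memHs_iff_gagliardo_lt_top hn hs0 hs1 _).mp (memHs_testL2 ψ)).ne⟩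
    rw [← eLpNorm_testL2]
    exact (ENNReal.pow_lt_top (Lp.memLp _).2).ne
  have hA0 : A ≠ 0 := by
    intro h0
    have h1 : eLpNorm ψ 2 volume = 0 := by simpa using (add_eq_zero.mp h0).1
    rw [eLpNorm_eq_zero_iff ψ.continuous.aestronglyMeasurable (by simp)] at h1
    have h2 : b x₀ = 0 :=
      congrFun ((ψ.continuous.ae_eq_iff_eq volume continuous_zero).mp h1) x₀
    rw [b.one_of_mem_closedBall (Metric.mem_closedBall_self (by positivity))] at h2
    exact one_ne_zero h2
  have hApos : 0 < A.toReal := ENNReal.toReal_pos hA0 hAt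
  set c : ℝ := (√A.toReal)⁻¹ with hc
  have hcA : ‖c‖ₑ ^ 2 * A = 1 := by
    rw [← enorm_pow, Real.enorm_of_nonneg (sq_nonneg _), hc, inv_pow, Real.sq_sqrt hApos.le,
      ENNReal.ofReal_inv_of_pos hApos, ENNReal.ofReal_toReal hAt, ENNReal.inv_mul_cancel hA0 hAt]
  refine ⟨c • ψ, ?_, ?_⟩
  · calc tsupport (c • ψ : 𝓓(W, ℝ)) ⊆ tsupport ψ :=
          closure_mono (Function.support_const_smul_subset c ψ)
      _ ⊆ _ := hbs.trans (Metric.closedBall_subset_ball hRr)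
  · have h1 : eLpNorm (c • ψ : 𝓓(W, ℝ)) 2 volume = ‖c‖ₑ * eLpNorm ψ 2 volume :=
      eLpNorm_const_smul c ψ 2 volume
    rw [h1, eLpNorm_fracGrad_sq hs0 hs1, testL2_smul, gagliardo_congr (Lp.coeFn_smul c (testL2 ψ)),
      gagliardo_const_smul, ← hcA, hA]
    ring

/-- Normalized bumps in balls of radius `1/(N+1)` suffice. Each ball lies in a strip of width
`2/(N+1)`, so the strip inequality and energy at most `1` force the `L²` norms to zero. -/
theorem exists_concentratesAt (hn : 1 ≤ n) (hs0 : 0 < s) (hs1 : s < 1)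
    {W : Opens (Rn n)} {x₀ : Rn n} (hx₀ : x₀ ∈ W) :
    ∃ φ : ℕ → 𝓓(W, ℝ), ConcentratesAt s φ x₀ := by
  have hr : ∀ N : ℕ, (0 : ℝ) < 1 / ((N : ℝ) + 1) := fun N => Nat.one_div_pos_of_nat
  choose φ hsupp hnorm using fun N : ℕ => exists_normalized_testFunction hn hs0 hs1 hx₀ (hr N)
  refine ⟨φ, hnorm, ?_, fun ε hε => ?_⟩
  · have hcpos := fracConst_pos (n := n) hs0 hs1
    -- Any unit vector would do as the normal of the strip; the first coordinate exists because `n ≥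
    -- 1`.
    set v : Rn n := EuclideanSpace.single ⟨0, hn⟩ 1 with hv
    have hv1 : ‖v‖ = 1 := by simp [hv]
    set κ : ℝ≥0∞ := ENNReal.ofReal (fracConst n s / 2) * (ENNReal.ofReal
      ((4 : ℝ) ^ (-((n : ℝ) + 2 * s))) * volume (Metric.ball (0 : Rn n) 1)) with hκ
    have hκ0 : κ ≠ 0 := mul_ne_zero (ENNReal.ofReal_pos.mpr (by positivity)).ne'
      (mul_ne_zero (ENNReal.ofReal_pos.mpr (by positivity)).ne'
        (Metric.measure_ball_pos _ _ one_pos).ne')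
    have hκt : κ ≠ ⊤ := ENNReal.mul_ne_top ENNReal.ofReal_ne_top
      (ENNReal.mul_ne_top ENNReal.ofReal_ne_top measure_ball_lt_top.ne)
    have hbound : ∀ N : ℕ, eLpNorm (φ N) 2 volume ^ 2 ≤
        κ⁻¹ * ENNReal.ofReal ((2 * (1 / ((N : ℝ) + 1))) ^ (2 * s)) := by
      intro N
      set ε : ℝ := 2 * (1 / ((N : ℝ) + 1)) with hε
      have hε0 : 0 < ε := by positivity
      have h := eLpNorm_le_gagliardo_of_strip hs0 (u := testL2 (φ N)) hv1
        (a := inner ℝ v x₀ - 1 / ((N : ℝ) + 1)) hε0 ?_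
      · rw [← eLpNorm_two_sq, eLpNorm_testL2] at h
        have h1 : ENNReal.ofReal (fracConst n s / 2) * gagliardo s (testL2 (φ N)) ≤ 1 := by
          rw [← eLpNorm_fracGrad_sq hs0 hs1, ← hnorm N]; exact le_add_self
        -- The powers `ε^{-n}` and `ε^n` cancel. The remaining `ε^{-2s}` produces the decay of the
        -- `L²` norm.
        have h2 : ENNReal.ofReal ((4 * ε) ^ (-((n : ℝ) + 2 * s)) * ε ^ n) =
            ENNReal.ofReal ((4 : ℝ) ^ (-((n : ℝ) + 2 * s))) * (ENNReal.ofReal (ε ^ (2 * s)))⁻¹ := by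
          rw [← ENNReal.ofReal_inv_of_pos (by positivity), ← ENNReal.ofReal_mul (by positivity),
            Real.mul_rpow (by norm_num) hε0.le, mul_assoc, ← Real.rpow_natCast, ← Real.rpow_add hε0,
            ← Real.rpow_neg hε0.le]
          congr 3; ring
        have h3 : κ * ((ENNReal.ofReal (ε ^ (2 * s)))⁻¹ * eLpNorm (φ N) 2 volume ^ 2) ≤ 1 := by
          refine le_trans (le_of_eq ?_) ((mul_le_mul_right h _).trans h1)
          rw [h2, hκ]; ring
        have hp0 : ENNReal.ofReal (ε ^ (2 * s)) ≠ 0 := (ENNReal.ofReal_pos.mpr (by positivity)).ne'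
        rw [mul_left_comm, ← ENNReal.div_eq_inv_mul,
          ENNReal.div_le_iff hp0 ENNReal.ofReal_ne_top, one_mul] at h3
        rwa [← ENNReal.div_eq_inv_mul, ENNReal.le_div_iff_mul_le (Or.inl hκ0) (Or.inl hκt),
          mul_comm]
      · refine (testL2_ae_eq_zero (φ N) (hsupp N)).mono fun x hx hxS => hx fun hxb => hxS ?_
        rw [mem_ball_iff_norm] at hxb
        have h1 : |inner ℝ v (x - x₀)| ≤ ‖x - x₀‖ := by
          simpa [hv1] using abs_real_inner_le_norm v (x - x₀)
        rw [inner_sub_right, abs_le] at h1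
        constructor <;> linarith [h1.1, h1.2]
    have hlim : Tendsto (fun N : ℕ => κ⁻¹ * ENNReal.ofReal ((2 * (1 / ((N : ℝ) + 1))) ^ (2 * s)))
        atTop (𝓝 0) := by
      have h1 : Tendsto (fun N : ℕ => (2 * (1 / ((N : ℝ) + 1))) ^ (2 * s)) atTop (𝓝 0) := by
        have h2 := (tendsto_one_div_add_atTop_nhds_zero_nat (𝕜 := ℝ)).const_mul 2
        have h3 := h2.rpow_const (p := 2 * s) (Or.inr (by positivity))
        rwa [mul_zero, Real.zero_rpow (by positivity)] at h3
      have h4 := ENNReal.tendsto_ofReal h1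
      simpa using ENNReal.Tendsto.const_mul h4 (Or.inr (ENNReal.inv_ne_top.mpr hκ0))
    rw [ENNReal.tendsto_nhds_zero]
    intro η hη
    filter_upwards [ENNReal.tendsto_nhds_zero.mp hlim (η ^ 2) (ENNReal.pow_pos hη 2)] with N hN
    exact (ENNReal.pow_le_pow_left_iff (n := 2) (by norm_num)).mp ((hbound N).trans hN)
  · have h := (tendsto_one_div_add_atTop_nhds_zero_nat (𝕜 := ℝ)).eventually (gt_mem_nhds hε)
    filter_upwards [h] with N hN
    exact (hsupp N).trans (Metric.ball_subset_ball hN.le)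

end FracCond

/-! ### Exterior determination and reconstruction -/

open FracCond in
theorem theorem3p2 (n : ℕ) (s : ℝ) (hs0 : 0 < s) (hs1 : s < 1)
    (Ω : Opens (Rn n)) (hΩ : BoundedInOneDirection (Ω : Set (Rn n)))
    (W : Opens (Rn n)) (hW : (W : Set (Rn n)).Nonempty)
    (hWΩ : (W : Set (Rn n)) ⊆ (closure (Ω : Set (Rn n)))ᶜ) :
    -- exterior determination
    (∀ γ₁ γ₂ : Rn n → ℝ, IsConductivity γ₁ → IsConductivity γ₂ →
      (∀ᵐ x ∂(volume.restrict (W : Set (Rn n))), ContinuousAt γ₁ x) →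
      (∀ᵐ x ∂(volume.restrict (W : Set (Rn n))), ContinuousAt γ₂ x) →
      (∀ f g : 𝓓(W, ℝ),
        dnMap Ω s γ₁ (testL2 f) (testL2 g) = dnMap Ω s γ₂ (testL2 f) (testL2 g)) →
      γ₁ =ᵐ[volume.restrict (W : Set (Rn n))] γ₂) ∧
    -- reconstruction, with test functions that do not depend on the conductivity
    (∃ φ : Rn n → ℕ → 𝓓(W, ℝ), ∀ x₀ ∈ W,
      ConcentratesAt s (φ x₀) x₀ ∧
      ∀ γ : Rn n → ℝ, IsConductivity γ → ContinuousAt γ x₀ →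
        Tendsto (fun N => dnMap Ω s γ (testL2 (φ x₀ N)) (testL2 (φ x₀ N))) atTop (𝓝 (γ x₀))) := by
  obtain ⟨v₀, hv₀, -⟩ := id hΩ
  -- A unit normal vector exists, which rules out dimension `0`.
  have hn : 1 ≤ n := by
    rcases n with _ | n
    · rw [Subsingleton.elim v₀ 0, norm_zero] at hv₀
      exact absurd hv₀ zero_ne_one
    · omega
  have hex : ∀ x₀ : Rn n, ∃ φ : ℕ → 𝓓(W, ℝ), x₀ ∈ W → ConcentratesAt s φ x₀ := by
    intro x₀
    by_cases hx₀ : x₀ ∈ W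
    · obtain ⟨φ, hφ⟩ := exists_concentratesAt hn hs0 hs1 hx₀
      exact ⟨φ, fun _ => hφ⟩
    · exact ⟨fun _ => 0, fun h => absurd h hx₀⟩
  choose φ hφ using hex
  have hlim : ∀ x₀ ∈ W, ∀ γ : Rn n → ℝ, IsConductivity γ → ContinuousAt γ x₀ →
      Tendsto (fun N => dnMap Ω s γ (testL2 (φ x₀ N)) (testL2 (φ x₀ N))) atTop (𝓝 (γ x₀)) :=
    fun x₀ hx₀ γ hγ hc =>
      tendsto_dnMap_of_concentratesAt hn hs0 hs1 hΩ (hWΩ hx₀) (hφ x₀ hx₀) hγ hc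
  refine ⟨fun γ₁ γ₂ hγ₁ hγ₂ hc₁ hc₂ heq => ?_, φ, fun x₀ hx₀ => ⟨hφ x₀ hx₀, hlim x₀ hx₀⟩⟩
  filter_upwards [hc₁, hc₂, ae_restrict_mem W.isOpen.measurableSet] with x h1 h2 hx
  -- The same test functions serve both conductivities, so the two limits are limits of one
  -- sequence.
  refine tendsto_nhds_unique (hlim x hx γ₁ hγ₁ h1) ?_
  simp_rw [heq]
  exact hlim x hx γ₂ hγ₂ h2
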